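/- Let $k$ be an algebraically closed field. For a finite set $E$ put $k_E:=\prod_{p\in E}k$ and $k^*_E:=\prod_{p\in E}k^*$; for $F\subseteq E$ regard $k_F$ as the subspace of $k_E$ of vectors whose coordinates outside $F$ are zero. The group $k^*_E$ acts diagonally on $k_E$, hence on the Grassmannian $\mathrm{Grass}_h(k_E)$ of $h$-dimensional subspaces of $k_E$. Let $\Delta$ be a finite set, let $I$ and $J$ be non-empty subsets of $\Delta$, and let $V\subseteq k_I$ and $W\subseteq k_J$ be non-zero vector subspaces. Put $h_1:=\dim V$, $h_2:=\dim W$, $G_1:=\mathrm{Grass}_{h_1}(k_I)$ and $G_2:=\mathrm{Grass}_{h_2}(k_J)$. An ordered tripartition of a set $S$ is a triple $(S',\overline S,S'')$ of pairwise disjoint, possibly empty, subsets with union $S$. For each ordered tripartition $\mathbb I=(I',\overline I,I'')$ of $I$ and each ordered tripartition $\mathbb J=(J',\overline J,J'')$ of $J$ put \[ V_{\mathbb I}:=k_{I'}+\bigl(k_{\overline I}\cap(V+k_{I''})\bigr),\qquad W_{\mathbb J}:=k_{J'}+\bigl(k_{\overline J}\cap(W+k_{J''})\bigr). \] Let $\lambda,\tau$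 be positive integers, and let \[ T:=\{(s,t)\in k_I^*\times k_J^*\;:\; s_i^{\tau}t_j^{\lambda}=s_j^{\tau}t_i^{\lambda}\ \text{ for all } i,j\in I\cap J\}, \] which acts on $G_1\times G_2$. Assume that all Plücker coordinates of $V$ in $G_1$ and of $W$ in $G_2$ are non-zero. Then $\dim V_{\mathbb I}=h_1$ whenever $|I'|<h_1\le|I\setminus I''|$, and $\dim W_{\mathbb J}=h_2$ whenever $|J'|<h_2\le|J\setminus J''|$. Moreover, the Zariski closure in $G_1\times G_2$ of the $T$-orbit of $(V,W)$ is the union of the $T$-orbits of the points $(V_{\mathbb I},W_{\mathbb J})$, over all pairs of ordered tripartitions $\mathbb I$ of $I$ and $\mathbb J$ of $J$ that satisfy \[ |I'|<h_1\le |I\setminus I''|\quad\text{and}\quad |J'|<h_2\le|J\setminus J''| \] and the following two conditions: (a) if $I'\cap J\not\subseteq J'\cap I$ or $J''\cap I\not\subseteq I''\cap J$, then $J\cap(I\setminus I')\subseteq J''\cap I$; (b) if $J'\cap I\not\subseteq I'\cap J$ or $I''\cap J\not\subseteq J''\cap I$, then $I\cap(J\setminus J')\subseteq I''\cap J$. 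-/

import Mathlib

open Module

noncomputable section

namespace GrassOrbit

/-- The Grassmannian of `h`-dimensional vector subspaces of `k_I = k^I` (as a set of closed points). -/
abbrev Gr (k : Type*) [Field k] (ι : Type*) (h : ℕ) : Type _ :=
  {V : Submodule k (ι → k) // finrank k V = h}

section Plucker

variable {k : Type*} [Field k] {ι : Type*} [Finite ι] {h : ℕ}

/-- Plücker coordinates of a subspace of `k^ι` with respect to a basis of it: the maximal minors
of the matrix whose rows are the basis vectors.  The `h` columns are chosen by an embedding
`c : Fin h ↪ ι`, that is, by an `h`-element subset of `ι` together with an enumeration of it; a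
change of the enumeration changes the minor only by a sign. -/
def pluckerOfBasis {V : Submodule k (ι → k)} (v : Basis (Fin h) k V) (c : Fin h ↪ ι) : k :=
  Matrix.det (Matrix.of fun i j : Fin h => (v i : ι → k) (c j))

/-- Homogeneous Plücker coordinates of a point of the Grassmannian (for a chosen basis). -/
def plucker (V : Gr k ι h) (c : Fin h ↪ ι) : k :=
  pluckerOfBasis (finBasisOfFinrankEq k V.1 V.2) c

/-- Up to a common nonzero factor, the Plücker coordinates do not depend on the basis. -/
theorem exists_pluckerOfBasis_eq (V : Gr k ι h) (v : Basis (Fin h) k V.1) :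
    ∃ a : kˣ, ∀ c, pluckerOfBasis v c = a * plucker V c := by
  set w := finBasisOfFinrankEq k V.1 V.2 with hw
  refine ⟨(w.isUnit_det v).unit, fun c => ?_⟩
  have key : (Matrix.of fun i j : Fin h => (v i : ι → k) (c j)) =
      (w.toMatrix v).transpose * (Matrix.of fun i j : Fin h => (w i : ι → k) (c j)) := by
    ext i j
    have h1 := congrArg (fun x : V.1 => (x : ι → k) (c j)) (w.sum_toMatrix_smul_self v i)
    simp only [Submodule.coe_sum, Submodule.coe_smul, Finset.sum_apply, Pi.smul_apply,
      smul_eq_mul] at h1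
    simp [Matrix.mul_apply, h1]
  simp only [plucker, pluckerOfBasis, IsUnit.unit_spec, ← hw, Basis.det_apply]
  rw [key, Matrix.det_mul, Matrix.det_transpose]

end Plucker

section Zariski

variable (k : Type*) [Field k] (ι κ : Type*) [Finite ι] [Finite κ] (h₁ h₂ : ℕ)

/-- Polynomials in the two groups of Plücker coordinates that are bihomogeneous, i.e. homogeneous
of some degree `d` in the first group and of some degree `e` in the second one. -/
def IsBihomogeneous (f : MvPolynomial ((Fin h₁ ↪ ι) ⊕ (Fin h₂ ↪ κ)) k) : Prop :=
  ∃ d e : ℕ, MvPolynomial.IsWeightedHomogeneous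
    (Sum.elim (fun _ => ((1, 0) : ℕ × ℕ)) (fun _ => ((0, 1) : ℕ × ℕ))) f (d, e)

/-- The Zariski topology of the projective variety `Gr × Gr`, in its Plücker embedding into a
product of two projective spaces: a base of open sets is given by the non-vanishing loci of
bihomogeneous polynomials in the Plücker coordinates.  (It is finer than the product of the
Zariski topologies of the factors.) -/
abbrev zariski : TopologicalSpace (Gr k ι h₁ × Gr k κ h₂) :=
  TopologicalSpace.generateFrom
    {U | ∃ f : MvPolynomial ((Fin h₁ ↪ ι) ⊕ (Fin h₂ ↪ κ)) k, IsBihomogeneous k ι κ h₁ h₂ f ∧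
      U = {P | MvPolynomial.eval (Sum.elim (plucker P.1) (plucker P.2)) f ≠ 0}}

end Zariski

section Torus

variable {k : Type*} [Field k] {ι : Type*} {h : ℕ}

/-- The diagonal action of `s ∈ k*_ι` on `k_ι`. -/
def diag (s : ι → kˣ) : (ι → k) ≃ₗ[k] (ι → k) :=
  LinearEquiv.piCongrRight fun i => LinearEquiv.smulOfUnit (s i)

theorem diag_apply (s : ι → kˣ) (v : ι → k) (i : ι) : diag s v i = s i * v i := rfl

/-- The induced action of `s ∈ k*_ι` on the Grassmannian. -/
def act (s : ι → kˣ) (V : Gr k ι h) : Gr k ι h :=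
  ⟨V.1.map (diag s : (ι → k) →ₗ[k] (ι → k)), by
    rw [LinearEquiv.finrank_map_eq (diag s) V.1, V.2]⟩

end Torus

section Pair

variable {Δ : Type*}

/-- The subgroup `T` of `k*_I × k*_J` of all `(s, t)` with
`s_i ^ τ * t_j ^ λ = s_j ^ τ * t_i ^ λ` for all `i, j ∈ I ∩ J`. -/
def torus (k : Type*) [Field k] (I J : Finset Δ) (lam tau : ℕ) :
    Subgroup ((I → kˣ) × (J → kˣ)) where
  carrier := {p | ∀ (i j : Δ) (hiI : i ∈ I) (hiJ : i ∈ J) (hjI : j ∈ I) (hjJ : j ∈ J),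
    p.1 ⟨i, hiI⟩ ^ tau * p.2 ⟨j, hjJ⟩ ^ lam = p.1 ⟨j, hjI⟩ ^ tau * p.2 ⟨i, hiJ⟩ ^ lam}
  mul_mem' := by
    intro a b ha hb i j hiI hiJ hjI hjJ
    simp only [Prod.fst_mul, Prod.snd_mul, Pi.mul_apply, mul_pow]
    rw [mul_mul_mul_comm, ha i j hiI hiJ hjI hjJ, hb i j hiI hiJ hjI hjJ, mul_mul_mul_comm]
  one_mem' := by
    intro i j hiI hiJ hjI hjJ
    simp
  inv_mem' := by
    intro a ha i j hiI hiJ hjI hjJ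
    simp only [Prod.fst_inv, Prod.snd_inv, Pi.inv_apply, inv_pow]
    rw [← mul_inv, ← mul_inv, ha i j hiI hiJ hjI hjJ]

/-- The orbit of a point of `Gr × Gr` under a subgroup of `k*_I × k*_J`. -/
def orbit {k : Type*} [Field k] {I J : Finset Δ} {h₁ h₂ : ℕ}
    (T : Subgroup ((I → kˣ) × (J → kˣ))) (P : Gr k I h₁ × Gr k J h₂) :
    Set (Gr k I h₁ × Gr k J h₂) :=
  {Q | ∃ p ∈ T, Q = (act p.1 P.1, act p.2 P.2)}

/-- Ordered tripartitions `(I', Ī, I'')` of `I`; the parts may be empty. -/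
structure Tripartition [DecidableEq Δ] (I : Finset Δ) where
  /-- the first part, `I'` -/
  fst : Finset Δ
  /-- the middle part, `Ī` -/
  mid : Finset Δ
  /-- the last part, `I''` -/
  lst : Finset Δ
  disjoint_fst_mid : Disjoint fst mid
  disjoint_fst_lst : Disjoint fst lst
  disjoint_mid_lst : Disjoint mid lst
  union_eq : fst ∪ mid ∪ lst = I

/-- The subspace `k_E` of `k_I`: the vectors whose coordinates outside `E` vanish. -/
def coordSubspace (k : Type*) [Field k] (I E : Finset Δ) : Submodule k (I → k) where
  carrier := {v | ∀ i : I, (i : Δ) ∉ E → v i = 0}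
  add_mem' := by
    intro a b ha hb i hi
    simp [ha i hi, hb i hi]
  zero_mem' := by
    intro i _
    rfl
  smul_mem' := by
    intro c a ha i hi
    simp [ha i hi]

variable [DecidableEq Δ]

/-- The subspace `V_𝕀 = k_{I'} + (k_Ī ∩ (V + k_{I''}))` attached to `V` and `𝕀 = (I', Ī, I'')`. -/
def degeneration {k : Type*} [Field k] {I : Finset Δ} (V : Submodule k (I → k))
    (A : Tripartition I) : Submodule k (I → k) :=
  coordSubspace k I A.fst ⊔ (coordSubspace k I A.mid ⊓ (V ⊔ coordSubspace k I A.lst))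

/-- The cardinality bounds `|I'| < h ≤ |I - I''|`. -/
def Tripartition.Bounds {I : Finset Δ} (A : Tripartition I) (h : ℕ) : Prop :=
  A.fst.card < h ∧ h ≤ (I \ A.lst).card

/-- The two compatibility conditions between a tripartition `(I', Ī, I'')` of `I` and a
tripartition `(J', J̄, J'')` of `J`. -/
def Compatible {I J : Finset Δ} (A : Tripartition I) (B : Tripartition J) : Prop :=
  ((¬ A.fst ∩ J ⊆ B.fst ∩ I ∨ ¬ B.lst ∩ I ⊆ A.lst ∩ J) → J ∩ (I \ A.fst) ⊆ B.lst ∩ I) ∧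
  ((¬ B.fst ∩ I ⊆ A.fst ∩ J ∨ ¬ A.lst ∩ J ⊆ B.lst ∩ I) → I ∩ (J \ B.fst) ⊆ A.lst ∩ J)

end Pair

end GrassOrbit

end

open GrassOrbit

open Module

noncomputable section

namespace GrassOrbit

section PluckerLemmas

variable {k : Type*} [Field k] {ι : Type*} {h : ℕ}

theorem pluckerOfBasis_update {V : Submodule k (ι → k)} {v : Basis (Fin h) k V} {c : Fin h ↪ ι}
    (hv : ∀ i j, (v i : ι → k) (c j) = if j = i then 1 else 0) (i : Fin h) (c' : Fin h ↪ ι) (j : ι)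
    (hc' : ∀ l, c' l = Function.update c i j l) : pluckerOfBasis v c' = (v i : ι → k) j := by
  have h1 := Matrix.cramer_apply (1 : Matrix (Fin h) (Fin h) k) (fun l => (v l : ι → k) j) i
  rw [Matrix.cramer_one] at h1
  simp only [Module.End.one_apply] at h1
  rw [h1, pluckerOfBasis]
  congr 1
  ext a b
  rw [Matrix.of_apply, hc', Matrix.updateCol_apply, Function.update_apply]
  split_ifs with hb
  · rfl
  · rw [hv, Matrix.one_apply]
    simp [eq_comm]

variable [Finite ι]

theorem plucker_act (s : ι → kˣ) (V : Gr k ι h) :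
    ∃ a : kˣ, ∀ c, plucker (act s V) c = a * ((∏ i, (s (c i) : k)) * plucker V c) := by
  set w := finBasisOfFinrankEq k V.1 V.2 with hw
  let w' : Basis (Fin h) k (act s V).1 := w.map ((diag s).submoduleMap V.1)
  obtain ⟨a, ha⟩ := exists_pluckerOfBasis_eq (act s V) w'
  refine ⟨a⁻¹, fun c => ?_⟩
  have h1 : pluckerOfBasis w' c = (∏ i, (s (c i) : k)) * plucker V c := by
    have h2 : ∀ i, ((w' i : (act s V).1) : ι → k) = diag s (w i : ι → k) := fun i => rfl
    simp only [plucker, pluckerOfBasis, ← hw, h2, diag_apply]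
    exact Matrix.det_mul_row _ _
  rw [← h1, ha]
  simp

theorem exists_plucker_ne_zero (V : Gr k ι h) : ∃ c, plucker V c ≠ 0 := by
  have := Fintype.ofFinite ι
  set w := finBasisOfFinrankEq k V.1 V.2 with hw
  let M : Matrix (Fin h) ι k := Matrix.of fun i j => (w i : ι → k) j
  have hli : LinearIndependent k M.row :=
    w.linearIndependent.map' V.1.subtype (Submodule.ker_subtype _)
  have hrank : M.rank = h := by simpa using hli.rank_matrix
  obtain ⟨κ, a, hinj, hspan, hind⟩ := exists_linearIndependent' k M.col
  have : Finite κ := Finite.of_injective a hinj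
  have := Fintype.ofFinite κ
  have hcard : Fintype.card κ = h := by
    rw [← finrank_span_eq_card hind, hspan, ← Matrix.rank_eq_finrank_span_cols, hrank]
  let e : Fin h ≃ κ := (Fintype.equivFinOfCardEq hcard).symm
  refine ⟨⟨a ∘ e, hinj.comp e.injective⟩, ?_⟩
  have hcol : LinearIndependent k (M.submatrix id (a ∘ e)).col := hind.comp e e.injective
  have hu := Matrix.linearIndependent_cols_iff_isUnit.1 hcol
  exact ((Matrix.isUnit_iff_isUnit_det _).1 hu).ne_zero

/-- The basis of `V` dual to the coordinates chosen by `c`. -/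
theorem exists_reduced_basis (V : Gr k ι h) {c : Fin h ↪ ι} (hc : plucker V c ≠ 0) :
    ∃ v : Basis (Fin h) k V.1, ∀ i j, (v i : ι → k) (c j) = if j = i then 1 else 0 := by
  set w := finBasisOfFinrankEq k V.1 V.2 with hw
  let f : V.1 →ₗ[k] (Fin h → k) := LinearMap.funLeft k k c ∘ₗ V.1.subtype
  have hf : Function.Injective f := by
    rw [← LinearMap.ker_eq_bot, LinearMap.ker_eq_bot']
    intro x hx
    have h0 : w.repr x = 0 := by
      have h1 := Matrix.eq_zero_of_vecMul_eq_zero hc (v := w.repr x) (by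
        ext j
        have h2 : (x : ι → k) (c j) = 0 := congrFun hx j
        have h3 := congrArg (fun x : V.1 => (x : ι → k) (c j)) (w.sum_repr x)
        simp only [Submodule.coe_sum, Submodule.coe_smul, Finset.sum_apply, Pi.smul_apply,
          smul_eq_mul, h2] at h3
        simpa [Matrix.vecMul, dotProduct, ← hw] using h3)
      ext i
      exact congrFun h1 i
    simpa using h0
  let e := f.linearEquivOfInjective hf (by simp [V.2])
  refine ⟨Basis.ofEquivFun e, fun i j => ?_⟩
  have h1 : e (Basis.ofEquivFun e i) j = (Pi.single i 1 : Fin h → k) j := by simp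
  rw [Pi.single_apply] at h1
  exact h1

theorem eq_of_plucker_eq {V V' : Gr k ι h} {a : k}
    (ha : ∀ c, plucker V' c = a * plucker V c) : V = V' := by
  obtain ⟨c, hc'⟩ := exists_plucker_ne_zero V'
  have hc : plucker V c ≠ 0 := fun h0 => hc' (by rw [ha, h0, mul_zero])
  obtain ⟨v, hv⟩ := exists_reduced_basis V hc
  obtain ⟨v', hv'⟩ := exists_reduced_basis V' hc'
  obtain ⟨b, hb⟩ := exists_pluckerOfBasis_eq V v
  obtain ⟨b', hb'⟩ := exists_pluckerOfBasis_eq V' v'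
  have hone : ∀ {X : Submodule k (ι → k)} {v : Basis (Fin h) k X},
      (∀ i j, (v i : ι → k) (c j) = if j = i then 1 else 0) → pluckerOfBasis v c = 1 := by
    intro X v hv
    rw [pluckerOfBasis, ← Matrix.det_one (n := Fin h)]
    congr 1
    ext i j
    simp [hv, Matrix.one_apply, eq_comm]
  have h1 := hone hv
  have h1' := hone hv'
  have hab : (b : k) = b' * a := by
    rw [hb] at h1
    rw [hb', ha, ← h1, ← mul_assoc] at h1'
    exact (mul_right_cancel₀ hc h1').symm
  have heq : ∀ i, (v i : ι → k) = v' i := by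
    intro i
    ext j
    by_cases hj : j ∈ Set.range c
    · obtain ⟨l, rfl⟩ := hj
      rw [hv, hv']
    · have hinj : Function.Injective (Function.update c i j) := by
        intro a b hab'
        simp only [Function.update_apply] at hab'
        split_ifs at hab' with h2 h3 h3
        · rw [h2, h3]
        · exact absurd ⟨b, hab'.symm⟩ hj
        · exact absurd ⟨a, hab'⟩ hj
        · exact c.injective hab'
      rw [← pluckerOfBasis_update hv i ⟨_, hinj⟩ j fun _ => rfl,
        ← pluckerOfBasis_update hv' i ⟨_, hinj⟩ j fun _ => rfl, hb, hb', ha, hab, mul_assoc]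
  have hsp : ∀ {X : Submodule k (ι → k)} (v : Basis (Fin h) k X),
      X = Submodule.span k (Set.range fun i => (v i : ι → k)) := by
    intro X v
    have h2 := congrArg (Submodule.map X.subtype) v.span_eq
    rw [Submodule.map_span, Submodule.map_top, Submodule.range_subtype, ← Set.range_comp] at h2
    exact h2.symm
  refine Subtype.ext ?_
  rw [hsp v, hsp v']
  simp only [heq]

end PluckerLemmas

section Image

variable {Δ : Type*} {I : Finset Δ} {h : ℕ}

/-- The `h`-element subset of `I` underlying a choice of `h` columns. -/
def cols (c : Fin h ↪ I) : Finset Δ :=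
  Finset.univ.map (c.trans (Function.Embedding.subtype _))

theorem mem_cols {c : Fin h ↪ I} {x : Δ} : x ∈ cols c ↔ ∃ i, (c i : Δ) = x := by
  simp [cols]

theorem cols_subset (c : Fin h ↪ I) : cols c ⊆ I := by
  intro x hx
  obtain ⟨i, rfl⟩ := mem_cols.1 hx
  exact (c i).2

theorem card_cols (c : Fin h ↪ I) : (cols c).card = h := by
  simp [cols]

@[to_additive]
theorem prod_cols {M : Type*} [CommMonoid M] (c : Fin h ↪ I) (f : Δ → M) :
    ∏ x ∈ cols c, f x = ∏ i, f (c i) := by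
  simp [cols]

theorem exists_cols_eq {S : Finset Δ} (hS : S ⊆ I) (hc : S.card = h) :
    ∃ c : Fin h ↪ I, cols c = S := by
  let e := S.equivFinOfCardEq hc
  refine ⟨⟨fun i => ⟨e.symm i, hS (e.symm i).2⟩, fun i j hij => ?_⟩, ?_⟩
  · exact e.symm.injective (Subtype.ext (congrArg (fun x : I => (x : Δ)) hij))
  · ext x
    refine mem_cols.trans ⟨?_, fun hx => ⟨e ⟨x, hx⟩, ?_⟩⟩
    · rintro ⟨i, rfl⟩
      exact (e.symm i).2
    · exact congrArg Subtype.val (e.symm_apply_apply ⟨x, hx⟩)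

end Image

section Limit

variable {Δ : Type*} [DecidableEq Δ] {I : Finset Δ}

/-- `a` is a weight whose sublevel, level and superlevel sets at `θ` are the parts of `A`. -/
def Tripartition.IsWeight (A : Tripartition I) (a : Δ → ℕ) (θ : ℕ) : Prop :=
  (∀ i ∈ A.fst, a i < θ) ∧ (∀ i ∈ A.mid, a i = θ) ∧ (∀ i ∈ A.lst, θ < a i)

theorem Tripartition.mem_cases (A : Tripartition I) {i : Δ} (hi : i ∈ I) :
    i ∈ A.fst ∨ i ∈ A.mid ∨ i ∈ A.lst := by
  rw [← A.union_eq] at hi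
  simpa [or_assoc] using hi

theorem Tripartition.fst_subset (A : Tripartition I) : A.fst ⊆ I :=
  fun _ hx => A.union_eq ▸ by simp [hx]

theorem Tripartition.mid_subset (A : Tripartition I) : A.mid ⊆ I :=
  fun _ hx => A.union_eq ▸ by simp [hx]

theorem Tripartition.lst_subset (A : Tripartition I) : A.lst ⊆ I :=
  fun _ hx => A.union_eq ▸ by simp [hx]

/-- The `h`-element sets between `I'` and the complement of `I''`. -/
def Tripartition.Between (A : Tripartition I) (S : Finset Δ) : Prop :=
  A.fst ⊆ S ∧ S ⊆ I \ A.lst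

theorem Tripartition.Bounds.exists_between {A : Tripartition I} {h : ℕ} (hA : A.Bounds h) :
    ∃ S, A.Between S ∧ S.card = h := by
  obtain ⟨S, h1, h2, h3⟩ := Finset.exists_subsuperset_card_eq (s := A.fst) (t := I \ A.lst)
    (fun x hx => Finset.mem_sdiff.2 ⟨A.fst_subset hx,
      Finset.disjoint_left.1 A.disjoint_fst_lst hx⟩) hA.1.le hA.2
  exact ⟨S, ⟨h1, h2⟩, h3⟩

theorem Tripartition.Bounds.exists_cols {A : Tripartition I} {h : ℕ} (hA : A.Bounds h) :
    ∃ c : Fin h ↪ I, A.Between (cols c) := by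
  obtain ⟨S, h1, h3⟩ := hA.exists_between
  obtain ⟨c, rfl⟩ := exists_cols_eq (h1.2.trans Finset.sdiff_subset) h3
  exact ⟨c, h1⟩

variable {k : Type*} [Field k] {h : ℕ}

/-- The initial forms, with respect to a weight, of a reduced basis of `V` for columns adapted to
`A` are a basis of `V_A`. -/
theorem exists_basis_degeneration {V : Submodule k (I → k)} {A : Tripartition I} {c : Fin h ↪ I}
    (hc : A.Between (cols c)) (v : Basis (Fin h) k V)
    (hv : ∀ i j, (v i : I → k) (c j) = if j = i then 1 else 0) {a : Δ → ℕ} {θ : ℕ}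
    (ha : A.IsWeight a θ) :
    ∃ w : Basis (Fin h) k (degeneration V A),
      ∀ i j, (w i : I → k) j = if a j = a (c i) then (v i : I → k) j else 0 := by
  obtain ⟨ha1, ha2, ha3⟩ := ha
  have hcl : ∀ i, (c i : Δ) ∈ A.fst ∨ (c i : Δ) ∈ A.mid := fun i => by
    have h1 := (Finset.mem_sdiff.1 (hc.2 (mem_cols.2 ⟨i, rfl⟩))).2
    have := A.mem_cases (c i).2
    tauto
  have hcf : ∀ j : I, (j : Δ) ∈ A.fst → ∃ i, c i = j := fun j hj => by
    obtain ⟨i, hi⟩ := mem_cols.1 (hc.1 hj)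
    exact ⟨i, Subtype.ext hi⟩
  let w : Fin h → I → k := fun i j => if a j = a (c i) then (v i : I → k) j else 0
  have hw : ∀ i j, w i j = if a j = a (c i) then (v i : I → k) j else 0 := fun _ _ => rfl
  have hwc : ∀ i j, w i (c j) = if j = i then 1 else 0 := by
    intro i j
    rw [hw, hv]
    split_ifs with h1 h2 h2
    · rfl
    · rfl
    · exact absurd (by rw [h2]) h1
    · rfl
  have hwf : ∀ i, (c i : Δ) ∈ A.fst → ∀ j, j ≠ c i → w i j = 0 := by
    intro i hi j hj
    rw [hw]
    split_ifs with h1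
    · have h2 := ha1 _ hi
      obtain ⟨l, rfl⟩ : ∃ l, c l = j := by
        rcases A.mem_cases j.2 with h3 | h3 | h3
        · exact hcf j h3
        · have := ha2 _ h3; omega
        · have := ha3 _ h3; omega
      rw [hv, if_neg]
      rintro rfl
      exact hj rfl
    · rfl
  have hwm : ∀ i, (c i : Δ) ∈ A.mid → ∀ j : I,
      w i j = if (j : Δ) ∈ A.mid then (v i : I → k) j else 0 := by
    intro i hi j
    rw [hw, ha2 _ hi]
    congr 1
    rw [eq_iff_iff]
    refine ⟨fun h1 => ?_, fun h1 => ha2 _ h1⟩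
    rcases A.mem_cases j.2 with h3 | h3 | h3
    · have := ha1 _ h3; omega
    · exact h3
    · have := ha3 _ h3; omega
  have hli : LinearIndependent k w := by
    rw [Fintype.linearIndependent_iff]
    intro g hg i
    have h1 := congrFun hg (c i)
    simpa [hwc] using h1
  have hspan : Submodule.span k (Set.range w) = degeneration V A := by
    apply le_antisymm
    · rw [Submodule.span_le]
      rintro _ ⟨i, rfl⟩
      rcases hcl i with hi | hi
      · refine Submodule.mem_sup_left fun j hj => hwf i hi j ?_
        rintro rfl
        exact hj hi
      · refine Submodule.mem_sup_right ⟨fun j hj => ?_, ?_⟩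
        · rw [hwm i hi, if_neg hj]
        · have h1 : w i = (v i : I → k) + (w i - v i) := by abel
          rw [h1]
          refine Submodule.add_mem_sup (v i).2 fun j hj => ?_
          rw [Pi.sub_apply, hwm i hi]
          split_ifs with h2
          · simp
          · have h3 : (j : Δ) ∈ A.fst := by
              have := A.mem_cases j.2
              tauto
            obtain ⟨l, rfl⟩ := hcf j h3
            rw [hv, if_neg, sub_zero]
            rintro rfl
            exact Finset.disjoint_left.1 A.disjoint_fst_mid h3 hi
    · refine sup_le ?_ ?_
      · intro x hx
        have h1 : x = ∑ i, x (c i) • w i := by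
          ext j
          simp only [Finset.sum_apply, Pi.smul_apply, smul_eq_mul]
          by_cases hj : (j : Δ) ∈ A.fst
          · obtain ⟨l, rfl⟩ := hcf j hj
            simp [hwc]
          · rw [hx j hj, Finset.sum_eq_zero]
            intro i _
            rcases hcl i with hi | hi
            · rw [hwf i hi, mul_zero]
              rintro rfl
              exact hj hi
            · rw [hx _ (Finset.disjoint_right.1 A.disjoint_fst_mid hi), zero_mul]
        rw [h1]
        exact Submodule.sum_mem _ fun i _ => Submodule.smul_mem _ _ (Submodule.subset_span ⟨i, rfl⟩)
      · rintro x ⟨hx, hx'⟩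
        obtain ⟨u, hu, y, hy, rfl⟩ := Submodule.mem_sup.1 hx'
        have hxu : ∀ j : I, (j : Δ) ∉ A.lst → (u + y) j = u j := by
          intro j hj
          simp [hy j hj]
        have hur : ∀ j, u j = ∑ i, u (c i) * (v i : I → k) j := by
          have h1 := v.sum_repr ⟨u, hu⟩
          have h2 : ∀ j, u j = ∑ i, v.repr ⟨u, hu⟩ i * (v i : I → k) j := by
            intro j
            have h3 := congrArg (fun x : V => (x : I → k) j) h1
            simpa only [Submodule.coe_sum, Submodule.coe_smul, Finset.sum_apply, Pi.smul_apply,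
              smul_eq_mul] using h3.symm
          intro j
          rw [h2 j]
          refine Finset.sum_congr rfl fun i _ => ?_
          rw [h2 (c i)]
          simp [hv]
        have hu0 : ∀ j : I, (j : Δ) ∈ A.fst → u j = 0 := by
          intro j hj
          rw [← hxu j (Finset.disjoint_left.1 A.disjoint_fst_lst hj)]
          exact hx j (Finset.disjoint_left.1 A.disjoint_fst_mid hj)
        have h1 : u + y = ∑ i, u (c i) • w i := by
          ext j
          simp only [Finset.sum_apply, Pi.smul_apply, smul_eq_mul]
          by_cases hj : (j : Δ) ∈ A.mid
          · rw [hxu j (Finset.disjoint_left.1 A.disjoint_mid_lst hj), hur j]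
            refine Finset.sum_congr rfl fun i _ => ?_
            rcases hcl i with hi | hi
            · rw [hu0 _ hi, zero_mul, zero_mul]
            · rw [hwm i hi, if_pos hj]
          · rw [hx j hj, Finset.sum_eq_zero]
            intro i _
            rcases hcl i with hi | hi
            · rw [hu0 _ hi, zero_mul]
            · rw [hwm i hi, if_neg hj, mul_zero]
        rw [h1]
        exact Submodule.sum_mem _ fun i _ => Submodule.smul_mem _ _ (Submodule.subset_span ⟨i, rfl⟩)
  refine ⟨(Basis.span hli).map (LinearEquiv.ofEq _ _ hspan), fun i j => ?_⟩
  rw [Basis.map_apply, LinearEquiv.coe_ofEq_apply, Basis.span_apply]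

/-- The weight with value `0`, `1`, `2` on the three parts. -/
def Tripartition.level (A : Tripartition I) (i : Δ) : ℕ :=
  if i ∈ A.fst then 0 else if i ∈ A.lst then 2 else 1

theorem Tripartition.isWeight_level (A : Tripartition I) : A.IsWeight A.level 1 := by
  refine ⟨fun i hi => ?_, fun i hi => ?_, fun i hi => ?_⟩
  · simp [level, hi]
  · simp [level, Finset.disjoint_right.1 A.disjoint_fst_mid hi,
      Finset.disjoint_left.1 A.disjoint_mid_lst hi]
  · simp [level, Finset.disjoint_right.1 A.disjoint_fst_lst hi, hi]

theorem finrank_degeneration {V : Gr k I h} (hV : ∀ c, plucker V c ≠ 0) {A : Tripartition I}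
    (hA : A.Bounds h) : finrank k (degeneration V.1 A) = h := by
  obtain ⟨c, hc⟩ := hA.exists_cols
  obtain ⟨v, hv⟩ := exists_reduced_basis V (hV c)
  obtain ⟨w, -⟩ := exists_basis_degeneration hc v hv A.isWeight_level
  simpa using finrank_eq_card_basis w

/-- The Plücker coordinates of `V_A` are, up to a common factor, the limits at `z = 0` of those of
`V` multiplied by powers of `z`. -/
theorem exists_plucker_degeneration {V : Gr k I h} (hV : ∀ c, plucker V c ≠ 0)
    {A : Tripartition I} (hA : finrank k (degeneration V.1 A) = h) {c : Fin h ↪ I}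
    (hc : A.Between (cols c)) {a : Δ → ℕ} {θ : ℕ} (ha : A.IsWeight a θ) :
    ∃ α : kˣ, ∀ c' : Fin h ↪ I, ∑ i ∈ cols c, a i ≤ ∑ i ∈ cols c', a i ∧
      plucker (⟨degeneration V.1 A, hA⟩ : Gr k I h) c' =
        α * (0 ^ (∑ i ∈ cols c', a i - ∑ i ∈ cols c, a i) * plucker V c') := by
  obtain ⟨v, hv⟩ := exists_reduced_basis V (hV c)
  obtain ⟨w, hw⟩ := exists_basis_degeneration hc v hv ha
  obtain ⟨β, hβ⟩ := exists_pluckerOfBasis_eq V v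
  obtain ⟨γ, hγ⟩ := exists_pluckerOfBasis_eq (⟨degeneration V.1 A, hA⟩ : Gr k I h) w
  have hle : ∀ i (j : I), (v i : I → k) j ≠ 0 → a (c i) ≤ a j := by
    intro i j hij
    by_cases hj : ∃ l, c l = j
    · obtain ⟨l, rfl⟩ := hj
      rw [hv] at hij
      rw [show l = i by by_contra h1; simp [h1] at hij]
    · have h1 : (j : Δ) ∉ A.fst := fun h1 => hj <| by
        obtain ⟨l, hl⟩ := mem_cols.1 (hc.1 h1)
        exact ⟨l, Subtype.ext hl⟩
      have h2 : a (c i) ≤ θ := by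
        have h3 := (Finset.mem_sdiff.1 (hc.2 (mem_cols.2 ⟨i, rfl⟩))).2
        rcases A.mem_cases (c i).2 with h4 | h4 | h4
        · exact (ha.1 _ h4).le
        · exact (ha.2.1 _ h4).le
        · exact absurd h4 h3
      refine h2.trans ?_
      rcases A.mem_cases j.2 with h4 | h4 | h4
      · exact absurd h4 h1
      · exact (ha.2.1 _ h4).ge
      · exact (ha.2.2 _ h4).le
  refine ⟨γ⁻¹ * β, fun c' => ?_⟩
  let M : Matrix (Fin h) (Fin h) (Polynomial k) := Matrix.of fun i j =>
    Polynomial.X ^ (a (c' j) - a (c i)) * Polynomial.C ((v i : I → k) (c' j))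
  have hM : (Polynomial.X : Polynomial k) ^ (∑ i ∈ cols c, a i) * M.det =
      Polynomial.X ^ (∑ i ∈ cols c', a i) * Polynomial.C (pluckerOfBasis v c') := by
    rw [sum_cols, sum_cols, ← Finset.prod_pow_eq_pow_sum, ← Finset.prod_pow_eq_pow_sum,
      ← Matrix.det_mul_column, pluckerOfBasis, RingHom.map_det, ← Matrix.det_mul_row]
    congr 1
    ext1 i j
    simp only [Matrix.of_apply, RingHom.mapMatrix_apply, Matrix.map_apply, M]
    by_cases h0 : (v i : I → k) (c' j) = 0
    · simp [h0]
    · rw [← mul_assoc, ← pow_add, Nat.add_sub_cancel' (hle i _ h0)]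
  have hne : pluckerOfBasis v c' ≠ 0 := by
    rw [hβ]
    exact mul_ne_zero β.ne_zero (hV c')
  have hdvd : (Polynomial.X : Polynomial k) ^ (∑ i ∈ cols c, a i) ∣
      Polynomial.X ^ (∑ i ∈ cols c', a i) * Polynomial.C (pluckerOfBasis v c') :=
    Dvd.intro _ hM
  have hρ : ∑ i ∈ cols c, a i ≤ ∑ i ∈ cols c', a i := by
    by_contra h1
    rw [Polynomial.X_pow_dvd_iff] at hdvd
    have h2 := hdvd _ (not_le.1 h1)
    simp at h2
    exact hne h2
  refine ⟨hρ, ?_⟩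
  have hdet : M.det = Polynomial.X ^ (∑ i ∈ cols c', a i - ∑ i ∈ cols c, a i) *
      Polynomial.C (pluckerOfBasis v c') := by
    apply mul_left_cancel₀ (pow_ne_zero (∑ i ∈ cols c, a i) Polynomial.X_ne_zero)
    rw [hM, ← mul_assoc, ← pow_add, Nat.add_sub_cancel' hρ]
  have heval : pluckerOfBasis w c' = Polynomial.evalRingHom 0 M.det := by
    rw [RingHom.map_det, pluckerOfBasis]
    congr 1
    ext i j
    simp only [Matrix.of_apply, RingHom.mapMatrix_apply, Matrix.map_apply, M, hw,
      Polynomial.coe_evalRingHom]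
    rw [Polynomial.eval_mul, Polynomial.eval_pow, Polynomial.eval_X, Polynomial.eval_C]
    by_cases h0 : (v i : I → k) (c' j) = 0
    · simp [h0]
    · have h1 := hle i _ h0
      rcases h1.eq_or_lt with h2 | h2
      · simp [h2]
      · rw [if_neg h2.ne', zero_pow (Nat.sub_pos_of_lt h2).ne', zero_mul]
  rw [hdet] at heval
  simp only [map_mul, Polynomial.coe_evalRingHom, Polynomial.eval_pow, Polynomial.eval_X,
    Polynomial.eval_C, hβ, hγ] at heval
  rw [Units.val_mul, mul_assoc, mul_left_comm (β : k), ← heval]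
  simp

theorem plucker_degeneration_eq {V : Gr k I h} (hV : ∀ c, plucker V c ≠ 0)
    {A : Tripartition I} (hA : finrank k (degeneration V.1 A) = h) (hb : A.Bounds h) :
    ∃ α : kˣ, ∀ c : Fin h ↪ I,
      (A.Between (cols c) →
        plucker (⟨degeneration V.1 A, hA⟩ : Gr k I h) c = α * plucker V c) ∧
      (¬ A.Between (cols c) → plucker (⟨degeneration V.1 A, hA⟩ : Gr k I h) c = 0) := by
  obtain ⟨c₀, hc₀⟩ := hb.exists_cols
  obtain ⟨α, hα⟩ := exists_plucker_degeneration hV hA hc₀ A.isWeight_level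
  have hlev : ∀ S : Finset Δ, S ⊆ I → ∑ i ∈ S, A.level i + (S ∩ A.fst).card =
      S.card + (S ∩ A.lst).card := by
    intro S hS
    rw [← Finset.filter_mem_eq_inter, ← Finset.filter_mem_eq_inter, Finset.card_filter,
      Finset.card_filter, Finset.card_eq_sum_ones, ← Finset.sum_add_distrib,
      ← Finset.sum_add_distrib]
    refine Finset.sum_congr rfl fun i hi => ?_
    have := fun h1 : i ∈ A.fst => Finset.disjoint_left.1 A.disjoint_fst_lst h1
    unfold Tripartition.level
    split_ifs <;> simp_all
  have hb' : ∀ c : Fin h ↪ I, A.Between (cols c) ↔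
      ∑ i ∈ cols c, A.level i ≤ ∑ i ∈ cols c₀, A.level i := by
    have hbt : ∀ c : Fin h ↪ I, A.Between (cols c) ↔
        A.fst.card ≤ (cols c ∩ A.fst).card ∧ (cols c ∩ A.lst).card = 0 := by
      intro c
      refine and_congr ⟨fun h1 => ?_, fun h1 => ?_⟩ ?_
      · rw [Finset.inter_eq_right.2 h1]
      · exact Finset.inter_eq_right.1 (Finset.eq_of_subset_of_card_le Finset.inter_subset_right h1)
      · rw [Finset.card_eq_zero, ← Finset.disjoint_iff_inter_eq_empty, Finset.subset_sdiff]
        simp [cols_subset]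
    intro c
    have h1 := hlev _ (cols_subset c)
    have h2 := hlev _ (cols_subset c₀)
    have h3 := (hbt c₀).1 hc₀
    have h4 : (cols c ∩ A.fst).card ≤ A.fst.card := Finset.card_le_card Finset.inter_subset_right
    have h5 : (cols c₀ ∩ A.fst).card ≤ A.fst.card := Finset.card_le_card Finset.inter_subset_right
    rw [card_cols] at h1 h2
    rw [hbt c]
    omega
  refine ⟨α, fun c => ⟨fun h1 => ?_, fun h1 => ?_⟩⟩
  · rw [(hα c).2, Nat.sub_eq_zero_of_le ((hb' c).1 h1), pow_zero, one_mul]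
  · rw [(hα c).2, zero_pow, zero_mul, mul_zero]
    have := (hb' c).not.1 h1
    omega

end Limit

section Compatibility

variable {Δ : Type*} [DecidableEq Δ] {I J : Finset Δ}

/-- `A` and `B` induce the same tripartition of `I ∩ J`. -/
def SameParts (A : Tripartition I) (B : Tripartition J) : Prop :=
  ∀ i ∈ I, i ∈ J → (i ∈ A.fst ↔ i ∈ B.fst) ∧ (i ∈ A.lst ↔ i ∈ B.lst)

/-- Every element of `I ∩ J` lies in `J'` or in `I''`. -/
def Above (A : Tripartition I) (B : Tripartition J) : Prop :=
  ∀ i ∈ I, i ∈ J → i ∈ B.fst ∨ i ∈ A.lst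

theorem SameParts.compatible {A : Tripartition I} {B : Tripartition J} (h : SameParts A B) :
    Compatible A B := by
  constructor
  · rintro (h1 | h1)
    · refine absurd (fun i hi => ?_) h1
      rw [Finset.mem_inter] at hi ⊢
      have := A.fst_subset hi.1
      exact ⟨((h i this hi.2).1).1 hi.1, this⟩
    · refine absurd (fun i hi => ?_) h1
      rw [Finset.mem_inter] at hi ⊢
      have := B.lst_subset hi.1
      exact ⟨((h i hi.2 this).2).2 hi.1, this⟩
  · rintro (h1 | h1)
    · refine absurd (fun i hi => ?_) h1
      rw [Finset.mem_inter] at hi ⊢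
      have := B.fst_subset hi.1
      exact ⟨((h i hi.2 this).1).2 hi.1, this⟩
    · refine absurd (fun i hi => ?_) h1
      rw [Finset.mem_inter] at hi ⊢
      have := A.lst_subset hi.1
      exact ⟨((h i this hi.2).2).1 hi.1, this⟩

theorem Above.compatible {A : Tripartition I} {B : Tripartition J} (h : Above A B) :
    Compatible A B := by
  constructor
  · rintro (h1 | h1)
    · refine absurd (fun i hi => ?_) h1
      rw [Finset.mem_inter] at hi ⊢
      have hI := A.fst_subset hi.1
      exact ⟨(h i hI hi.2).resolve_right (Finset.disjoint_left.1 A.disjoint_fst_lst hi.1), hI⟩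
    · refine absurd (fun i hi => ?_) h1
      rw [Finset.mem_inter] at hi ⊢
      have hJ := B.lst_subset hi.1
      exact ⟨(h i hi.2 hJ).resolve_left (Finset.disjoint_right.1 B.disjoint_fst_lst hi.1), hJ⟩
  · intro _ i hi
    simp only [Finset.mem_inter, Finset.mem_sdiff] at hi ⊢
    exact ⟨(h i hi.1 hi.2.1).resolve_left hi.2.2, hi.2.1⟩

theorem Compatible.symm {A : Tripartition I} {B : Tripartition J} (h : Compatible A B) :
    Compatible B A :=
  ⟨h.2, h.1⟩

theorem Compatible.trichotomy {A : Tripartition I} {B : Tripartition J} (h : Compatible A B) :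
    SameParts A B ∨ Above A B ∨ Above B A := by
  by_cases h1 : ¬ A.fst ∩ J ⊆ B.fst ∩ I ∨ ¬ B.lst ∩ I ⊆ A.lst ∩ J
  · refine Or.inr (Or.inr fun i hJ hI => ?_)
    by_cases hi : i ∈ A.fst
    · exact Or.inl hi
    · exact Or.inr (Finset.mem_inter.1 (h.1 h1 (by simp [hi, hI, hJ]))).1
  by_cases h2 : ¬ B.fst ∩ I ⊆ A.fst ∩ J ∨ ¬ A.lst ∩ J ⊆ B.lst ∩ I
  · refine Or.inr (Or.inl fun i hI hJ => ?_)
    by_cases hi : i ∈ B.fst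
    · exact Or.inl hi
    · exact Or.inr (Finset.mem_inter.1 (h.2 h2 (by simp [hi, hI, hJ]))).1
  · push Not at h1 h2
    refine Or.inl fun i hI hJ => ⟨⟨fun hi => ?_, fun hi => ?_⟩, ⟨fun hi => ?_, fun hi => ?_⟩⟩
    · exact (Finset.mem_inter.1 (h1.1 (Finset.mem_inter.2 ⟨hi, hJ⟩))).1
    · exact (Finset.mem_inter.1 (h2.1 (Finset.mem_inter.2 ⟨hi, hI⟩))).1
    · exact (Finset.mem_inter.1 (h2.2 (Finset.mem_inter.2 ⟨hi, hJ⟩))).1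
    · exact (Finset.mem_inter.1 (h1.2 (Finset.mem_inter.2 ⟨hi, hI⟩))).1

theorem Above.exists_weight {A : Tripartition I} {B : Tripartition J} (h : Above A B) :
    ∃ (n : Δ → ℕ) (θ θ' : ℕ), A.IsWeight n θ ∧ B.IsWeight n θ' := by
  have hA1 := fun i (hi : i ∈ A.fst) => Finset.disjoint_left.1 A.disjoint_fst_mid hi
  have hA2 := fun i (hi : i ∈ A.fst) => Finset.disjoint_left.1 A.disjoint_fst_lst hi
  have hA3 := fun i (hi : i ∈ A.mid) => Finset.disjoint_left.1 A.disjoint_mid_lst hi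
  have hB1 := fun i (hi : i ∈ B.fst) => Finset.disjoint_left.1 B.disjoint_fst_mid hi
  have hB2 := fun i (hi : i ∈ B.fst) => Finset.disjoint_left.1 B.disjoint_fst_lst hi
  have hB3 := fun i (hi : i ∈ B.mid) => Finset.disjoint_left.1 B.disjoint_mid_lst hi
  have hI1 := fun i (hi : i ∈ A.fst) => A.fst_subset hi
  have hI2 := fun i (hi : i ∈ A.mid) => A.mid_subset hi
  have hI3 := fun i (hi : i ∈ A.lst) => A.lst_subset hi
  have hJ1 := fun i (hi : i ∈ B.fst) => B.fst_subset hi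
  have hJ2 := fun i (hi : i ∈ B.mid) => B.mid_subset hi
  have hJ3 := fun i (hi : i ∈ B.lst) => B.lst_subset hi
  refine ⟨fun i => if i ∈ A.fst then 0 else if i ∈ A.mid then 1 else if i ∈ B.mid then 3 else
    if i ∈ B.lst then 4 else 2, 1, 3, ⟨?_, ?_, ?_⟩, ⟨?_, ?_, ?_⟩⟩
  all_goals
    intro i hi
    have := h i
    grind

theorem SameParts.exists_weight {A : Tripartition I} {B : Tripartition J} (h : SameParts A B) :
    ∃ (n : Δ → ℕ) (θ θ' : ℕ), A.IsWeight n θ ∧ B.IsWeight n θ' := by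
  have hA := A.isWeight_level
  have hB := B.isWeight_level
  have key : ∀ i ∈ J, (if i ∈ I then A.level i else B.level i) = B.level i := by
    intro i hJ
    split_ifs with hI
    · have := h i hI hJ
      simp [Tripartition.level, this.1, this.2]
    · rfl
  refine ⟨fun i => if i ∈ I then A.level i else B.level i, 1, 1,
    ⟨fun i hi => ?_, fun i hi => ?_, fun i hi => ?_⟩,
    ⟨fun i hi => ?_, fun i hi => ?_, fun i hi => ?_⟩⟩
  · simpa only [if_pos (A.fst_subset hi)] using hA.1 i hi
  · simpa only [if_pos (A.mid_subset hi)] using hA.2.1 i hi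
  · simpa only [if_pos (A.lst_subset hi)] using hA.2.2 i hi
  · simpa only [key i (B.fst_subset hi)] using hB.1 i hi
  · simpa only [key i (B.mid_subset hi)] using hB.2.1 i hi
  · simpa only [key i (B.lst_subset hi)] using hB.2.2 i hi

theorem Compatible.exists_weight {A : Tripartition I} {B : Tripartition J} (h : Compatible A B) :
    ∃ (n : Δ → ℕ) (θ θ' : ℕ), A.IsWeight n θ ∧ B.IsWeight n θ' := by
  rcases h.trichotomy with h | h | h
  · exact h.exists_weight
  · exact h.exists_weight
  · obtain ⟨n, θ, θ', h1, h2⟩ := h.exists_weight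
    exact ⟨n, θ', θ, h2, h1⟩

theorem Tripartition.IsWeight.const_mul {A : Tripartition I} {n : Δ → ℕ} {θ : ℕ}
    (h : A.IsWeight n θ) {m : ℕ} (hm : 0 < m) : A.IsWeight (fun i => m * n i) (m * θ) :=
  ⟨fun i hi => Nat.mul_lt_mul_of_pos_left (h.1 i hi) hm, fun i hi => congrArg (m * ·) (h.2.1 i hi),
    fun i hi => Nat.mul_lt_mul_of_pos_left (h.2.2 i hi) hm⟩

end Compatibility

section Closure

variable {k : Type*} [Field k]

theorem eval_isWeightedHomogeneous {σ : Type*} {w : σ → ℕ × ℕ} {f : MvPolynomial σ k} {d e : ℕ}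
    (hf : MvPolynomial.IsWeightedHomogeneous w f (d, e)) (a b : k) (x : σ → k) :
    MvPolynomial.eval (fun i => a ^ (w i).1 * b ^ (w i).2 * x i) f =
      a ^ d * b ^ e * MvPolynomial.eval x f := by
  rw [MvPolynomial.eval_eq, MvPolynomial.eval_eq, Finset.mul_sum]
  refine Finset.sum_congr rfl fun m hm => ?_
  have h1 := hf (MvPolynomial.mem_support_iff.1 hm)
  rw [Finsupp.weight_apply, Finsupp.sum] at h1
  have h2 := congrArg Prod.fst h1
  have h3 := congrArg Prod.snd h1
  simp only [Prod.fst_sum, Prod.snd_sum, Prod.smul_fst, Prod.smul_snd, smul_eq_mul] at h2 h3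
  simp only [mul_pow, Finset.prod_mul_distrib, ← pow_mul, Finset.prod_pow_eq_pow_sum]
  simp only [mul_comm (w _).1, mul_comm (w _).2, h2, h3]
  ring

variable {ι κ : Type*} {h₁ h₂ : ℕ}

theorem IsBihomogeneous.eval_mul_ne_zero_iff
    {f : MvPolynomial ((Fin h₁ ↪ ι) ⊕ (Fin h₂ ↪ κ)) k} (hf : IsBihomogeneous k ι κ h₁ h₂ f)
    (a b : kˣ) (x : (Fin h₁ ↪ ι) → k) (y : (Fin h₂ ↪ κ) → k) :
    MvPolynomial.eval (Sum.elim (fun c => a * x c) (fun c => b * y c)) f ≠ 0 ↔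
      MvPolynomial.eval (Sum.elim x y) f ≠ 0 := by
  obtain ⟨d, e, hf⟩ := hf
  have h1 := eval_isWeightedHomogeneous hf a b (Sum.elim x y)
  have h2 : (Sum.elim (fun c => (a : k) * x c) (fun c => (b : k) * y c)) = fun i =>
      (a : k) ^ (Sum.elim (fun _ => ((1, 0) : ℕ × ℕ)) (fun _ => ((0, 1) : ℕ × ℕ)) i).1 *
      (b : k) ^ (Sum.elim (fun _ => ((1, 0) : ℕ × ℕ)) (fun _ => ((0, 1) : ℕ × ℕ)) i).2 *
      Sum.elim x y i := by
    ext (i | i) <;> simp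
  rw [h2, h1]
  simp

theorem mem_closure_zariski_iff [Finite ι] [Finite κ] {S : Set (Gr k ι h₁ × Gr k κ h₂)} {P : Gr k ι h₁ × Gr k κ h₂} :
    P ∈ @closure _ (zariski k ι κ h₁ h₂) S ↔
      ∀ f, IsBihomogeneous k ι κ h₁ h₂ f →
        MvPolynomial.eval (Sum.elim (plucker P.1) (plucker P.2)) f ≠ 0 →
        ∃ Q ∈ S, MvPolynomial.eval (Sum.elim (plucker Q.1) (plucker Q.2)) f ≠ 0 := by
  let _ := zariski k ι κ h₁ h₂
  have hb := TopologicalSpace.isTopologicalBasis_of_subbasis_of_inter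
    (t := zariski k ι κ h₁ h₂) rfl (by
      rintro _ ⟨f, ⟨d, e, hf⟩, rfl⟩ _ ⟨g, ⟨d', e', hg⟩, rfl⟩
      refine ⟨f * g, ⟨d + d', e + e', hf.mul hg⟩, ?_⟩
      ext P
      simp)
  rw [hb.mem_closure_iff]
  constructor
  · intro h f hf hP
    obtain ⟨Q, hQ, hQS⟩ := h _ (Or.inr ⟨f, hf, rfl⟩) hP
    exact ⟨Q, hQS, hQ⟩
  · rintro h _ (rfl | ⟨f, hf, rfl⟩) hP
    · obtain ⟨Q, hQ, -⟩ := h 1 ⟨0, 0, MvPolynomial.isWeightedHomogeneous_one k _⟩ (by simp)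
      exact ⟨Q, trivial, hQ⟩
    · obtain ⟨Q, hQS, hQ⟩ := h f hf hP
      exact ⟨Q, hQ, hQS⟩

end Closure

section Degeneration

variable {k : Type*} [Field k] {Δ : Type*} {I J : Finset Δ} {h₁ h₂ : ℕ}

theorem exists_ne_zero_eval_ne_zero [Infinite k] {F : Polynomial k} (hF : F.eval 0 ≠ 0) :
    ∃ z : kˣ, F.eval (z : k) ≠ 0 := by
  classical
  have h0 : F ≠ 0 := by
    rintro rfl
    simp at hF
  obtain ⟨z, hz⟩ := Infinite.exists_notMem_finset (Polynomial.X * F).roots.toFinset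
  rw [Multiset.mem_toFinset, Polynomial.mem_roots (mul_ne_zero Polynomial.X_ne_zero h0),
    Polynomial.IsRoot, Polynomial.eval_mul, Polynomial.eval_X, mul_eq_zero, not_or] at hz
  exact ⟨Units.mk0 z hz.1, hz.2⟩

/-- The Plücker coordinates of `s z ^ a` times `V`. -/
theorem plucker_act_pow {V : Gr k I h₁} (s : I → kˣ) (z : kˣ) (a : Δ → ℕ) {ρ : ℕ}
    (hρ : ∀ c : Fin h₁ ↪ I, ρ ≤ ∑ i ∈ cols c, a i) :
    ∃ α : kˣ, plucker (act (fun i => s i * z ^ a i) V) = fun c =>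
      α * ((∏ i, (s (c i) : k)) * plucker V c * (z : k) ^ (∑ i ∈ cols c, a i - ρ)) := by
  obtain ⟨α, hα⟩ := plucker_act (fun i => s i * z ^ a i) V
  refine ⟨α * z ^ ρ, funext fun c => ?_⟩
  have h1 : (z : k) ^ (∑ i ∈ cols c, a i) = z ^ ρ * z ^ (∑ i ∈ cols c, a i - ρ) := by
    rw [← pow_add, Nat.add_sub_cancel' (hρ c)]
  simp only [hα, Units.val_mul, Units.val_pow_eq_pow_val, Finset.prod_mul_distrib,
    Finset.prod_pow_eq_pow_sum, ← sum_cols c a, h1]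
  ring

theorem degeneration_mem_closure [DecidableEq Δ] [Infinite k] {V : Gr k I h₁} {W : Gr k J h₂}
    {lam tau : ℕ} (hlam : 0 < lam) (htau : 0 < tau)
    (hV : ∀ c, plucker V c ≠ 0) (hW : ∀ c, plucker W c ≠ 0)
    {A : Tripartition I} {B : Tripartition J} (hA : A.Bounds h₁) (hB : B.Bounds h₂)
    (hAB : Compatible A B)
    (dA : finrank k (degeneration V.1 A) = h₁) (dB : finrank k (degeneration W.1 B) = h₂)
    {p : (I → kˣ) × (J → kˣ)} (hp : p ∈ torus k I J lam tau) :
    ((act p.1 ⟨degeneration V.1 A, dA⟩, act p.2 ⟨degeneration W.1 B, dB⟩) :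
        Gr k I h₁ × Gr k J h₂) ∈
      @closure _ (zariski k I J h₁ h₂) (orbit (torus k I J lam tau) (V, W)) := by
  rw [mem_closure_zariski_iff]
  intro f hf hne
  obtain ⟨n, θ, θ', hn, hn'⟩ := hAB.exists_weight
  obtain ⟨c, hc⟩ := hA.exists_cols
  obtain ⟨c', hc'⟩ := hB.exists_cols
  obtain ⟨α, hα⟩ := exists_plucker_degeneration hV dA hc (hn.const_mul hlam)
  obtain ⟨β, hβ⟩ := exists_plucker_degeneration hW dB hc' (hn'.const_mul htau)
  set a : Δ → ℕ := fun i => lam * n i with ha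
  set b : Δ → ℕ := fun i => tau * n i with hb
  set ρ := ∑ i ∈ cols c, a i
  set ρ' := ∑ i ∈ cols c', b i
  let x : k → (Fin h₁ ↪ I) → k := fun z c =>
    (∏ i, (p.1 (c i) : k)) * plucker V c * z ^ (∑ i ∈ cols c, a i - ρ)
  let y : k → (Fin h₂ ↪ J) → k := fun z c =>
    (∏ i, (p.2 (c i) : k)) * plucker W c * z ^ (∑ i ∈ cols c, b i - ρ')
  let F : Polynomial k := MvPolynomial.aeval (Sum.elim
    (fun c : Fin h₁ ↪ I => Polynomial.C ((∏ i, (p.1 (c i) : k)) * plucker V c) *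
      Polynomial.X ^ (∑ i ∈ cols c, a i - ρ))
    (fun c : Fin h₂ ↪ J => Polynomial.C ((∏ i, (p.2 (c i) : k)) * plucker W c) *
      Polynomial.X ^ (∑ i ∈ cols c, b i - ρ'))) f
  have hF : ∀ z, F.eval z = MvPolynomial.eval (Sum.elim (x z) (y z)) f := by
    intro z
    rw [← Polynomial.coe_aeval_eq_eval, ← AlgHom.comp_apply, MvPolynomial.comp_aeval,
      ← MvPolynomial.coe_aeval_eq_eval]
    refine congrArg (fun g => MvPolynomial.aeval g f) (funext ?_)
    rintro (i | i) <;> simp [x, y, Polynomial.eval_prod]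
  obtain ⟨z, hz⟩ := exists_ne_zero_eval_ne_zero (F := F) (by
    obtain ⟨α', hα'⟩ := plucker_act p.1 (⟨degeneration V.1 A, dA⟩ : Gr k I h₁)
    obtain ⟨β', hβ'⟩ := plucker_act p.2 (⟨degeneration W.1 B, dB⟩ : Gr k J h₂)
    have hx : (fun c => ((α' * α : kˣ) : k) * x 0 c) =
        plucker (act p.1 (⟨degeneration V.1 A, dA⟩ : Gr k I h₁)) := by
      ext i
      simp only [hα', (hα i).2, x, Units.val_mul]
      ring
    have hy : (fun c => ((β' * β : kˣ) : k) * y 0 c) =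
        plucker (act p.2 (⟨degeneration W.1 B, dB⟩ : Gr k J h₂)) := by
      ext i
      simp only [hβ', (hβ i).2, y, Units.val_mul]
      ring
    rw [hF, ← hf.eval_mul_ne_zero_iff (α' * α) (β' * β), hx, hy]
    exact hne)
  refine ⟨(act (fun i => p.1 i * z ^ a i) V, act (fun i => p.2 i * z ^ b i) W),
    ⟨p * (fun i : I => z ^ a i, fun i : J => z ^ b i), mul_mem hp ?_, rfl⟩, ?_⟩
  · intro i j hiI hiJ hjI hjJ
    simp only [ha, hb, ← pow_mul, ← pow_add]
    congr 1
    ring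
  · obtain ⟨α', hα'⟩ := plucker_act_pow (V := V) p.1 z a fun c => (hα c).1
    obtain ⟨β', hβ'⟩ := plucker_act_pow (V := W) p.2 z b fun c => (hβ c).1
    rw [hα', hβ', hf.eval_mul_ne_zero_iff, ← hF]
    exact hz

end Degeneration

section Exchange

variable {Δ : Type*} [DecidableEq Δ] {k : Type*} [Field k]

/-- The set `S` with `i` replaced by `j`. -/
def swap (S : Finset Δ) (i j : Δ) : Finset Δ :=
  insert j (S.erase i)

theorem mem_swap {S : Finset Δ} {i j x : Δ} : x ∈ swap S i j ↔ x = j ∨ x ≠ i ∧ x ∈ S := by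
  simp [swap]

theorem card_swap {S : Finset Δ} {i j : Δ} (hi : i ∈ S) (hj : j ∉ S) :
    (swap S i j).card = S.card := by
  rw [swap, Finset.card_insert_of_notMem (fun h => hj (Finset.mem_of_mem_erase h)),
    Finset.card_erase_add_one hi]

theorem swap_subset {S I : Finset Δ} {i j : Δ} (hS : S ⊆ I) (hj : j ∈ I) : swap S i j ⊆ I :=
  Finset.insert_subset hj ((Finset.erase_subset _ _).trans hS)

theorem prod_swap_mul {M : Type*} [CommMonoid M] {S : Finset Δ} {i j : Δ} (hi : i ∈ S)
    (hj : j ∉ S) (f : Δ → M) : (∏ x ∈ swap S i j, f x) * f i = (∏ x ∈ S, f x) * f j := by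
  rw [swap, Finset.prod_insert (fun h => hj (Finset.mem_of_mem_erase h)), mul_assoc, mul_comm,
    Finset.prod_erase_mul _ _ hi]

/-- A function on the `h`-element subsets of `I` (not identically zero) which satisfies the
two-term exchange relations. -/
structure IsExchange (I : Finset Δ) (h : ℕ) (U : Finset Δ → k) : Prop where
  supp : ∀ S, U S ≠ 0 → S ⊆ I ∧ S.card = h
  nonzero : ∃ S, U S ≠ 0
  exch : ∀ S S' i j, S ⊆ I → S.card = h → S' ⊆ I → S'.card = h → i ∈ S → i ∉ S' → j ∈ S' →
    j ∉ S → U S * U S' = U (swap S i j) * U (swap S' j i)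

variable {I J : Finset Δ} {h h₁ h₂ : ℕ} {U U₁ U₂ : Finset Δ → k}

/-- The support of `U` consists of the sets of cardinality `h` between `I'` and `I \ I''`. -/
def HasSupport (U : Finset Δ → k) (h : ℕ) (A : Tripartition I) : Prop :=
  ∀ S, U S ≠ 0 ↔ A.Between S ∧ S.card = h

theorem IsExchange.swap_ne_zero (hU : IsExchange I h U) {S S' : Finset Δ} {i j : Δ}
    (hS : U S ≠ 0) (hS' : U S' ≠ 0) (hi : i ∈ S) (hi' : i ∉ S') (hj : j ∈ S') (hj' : j ∉ S) :
    U (swap S i j) ≠ 0 := by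
  have h1 := hU.exch S S' i j (hU.supp S hS).1 (hU.supp S hS).2 (hU.supp S' hS').1
    (hU.supp S' hS').2 hi hi' hj hj'
  exact left_ne_zero_of_mul (h1 ▸ mul_ne_zero hS hS')

theorem exists_mem_notMem_of_card_eq {S T : Finset Δ} (h : S.card = T.card) {x : Δ} (hx : x ∈ S)
    (hx' : x ∉ T) : ∃ y ∈ T, y ∉ S := by
  by_contra! h1
  exact hx' (Finset.eq_of_subset_of_card_le h1 h.le ▸ hx)

theorem IsExchange.ne_zero_of_forall (hU : IsExchange I h U) {T : Finset Δ} (hT : T.card = h)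
    (h1 : ∀ x ∈ T, ∃ S, U S ≠ 0 ∧ x ∈ S) (h2 : ∀ x ∈ I, x ∉ T → ∃ S, U S ≠ 0 ∧ x ∉ S) :
    U T ≠ 0 := by
  have key : ∀ n S, U S ≠ 0 → (T \ S).card = n → U T ≠ 0 := by
    intro n
    induction n with
    | zero =>
      intro S hS hn
      rw [Finset.card_eq_zero, Finset.sdiff_eq_empty_iff_subset] at hn
      rwa [Finset.eq_of_subset_of_card_le hn (by rw [hT, (hU.supp S hS).2])]
    | succ n ih =>
      intro S hS hn
      obtain ⟨j, hj⟩ : (T \ S).Nonempty := by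
        rw [← Finset.card_pos]
        omega
      have hj' := Finset.mem_sdiff.1 hj
      obtain ⟨i, hi, hi'⟩ := exists_mem_notMem_of_card_eq (hT.trans (hU.supp S hS).2.symm) hj'.1
        hj'.2
      obtain ⟨S', hS', hjS', hiS'⟩ : ∃ S', U S' ≠ 0 ∧ j ∈ S' ∧ i ∉ S' := by
        obtain ⟨S₁, hS₁, hj₁⟩ := h1 j hj'.1
        obtain ⟨S₂, hS₂, hi₂⟩ := h2 i ((hU.supp S hS).1 hi) hi'
        by_cases hi₁ : i ∈ S₁
        · by_cases hj₂ : j ∈ S₂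
          · exact ⟨S₂, hS₂, hj₂, hi₂⟩
          · obtain ⟨l, hl, hl'⟩ := exists_mem_notMem_of_card_eq
              ((hU.supp S₁ hS₁).2.trans (hU.supp S₂ hS₂).2.symm) hi₁ hi₂
            refine ⟨swap S₁ i l, hU.swap_ne_zero hS₁ hS₂ hi₁ hi₂ hl hl', ?_, ?_⟩
            · rw [mem_swap]
              refine Or.inr ⟨?_, hj₁⟩
              rintro rfl
              exact hj'.2 hi
            · rw [mem_swap]
              rintro (rfl | h3)
              · exact hl' hi₁
              · exact h3.1 rfl
        · exact ⟨S₁, hS₁, hj₁, hi₁⟩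
      refine ih (swap S i j) (hU.swap_ne_zero hS hS' hi hiS' hjS' hj'.2) ?_
      have h3 : T \ swap S i j = (T \ S).erase j := by
        ext x
        simp only [Finset.mem_sdiff, mem_swap, Finset.mem_erase]
        by_cases hx : x = i
        · simp [hx, hi', hi]
        · tauto
      rw [h3, Finset.card_erase_of_mem hj, hn, Nat.add_sub_cancel]
  obtain ⟨S, hS⟩ := hU.nonzero
  exact key _ S hS rfl

theorem IsExchange.support_cases (hU : IsExchange I h U) :
    (∃ c, c ⊆ I ∧ c.card = h ∧ ∀ S, U S ≠ 0 ↔ S = c) ∨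
    ∃ A : Tripartition I, A.fst.card < h ∧ h < (I \ A.lst).card ∧ HasSupport U h A := by
  classical
  obtain ⟨S₀, hS₀⟩ := hU.nonzero
  let F := I.filter fun x => ∀ S, U S ≠ 0 → x ∈ S
  let L := I.filter fun x => ∀ S, U S ≠ 0 → x ∉ S
  have hFL : Disjoint F L := by
    rw [Finset.disjoint_left]
    intro x hx hx'
    exact (Finset.mem_filter.1 hx').2 S₀ hS₀ ((Finset.mem_filter.1 hx).2 S₀ hS₀)
  let A : Tripartition I :=
    { fst := F
      mid := I \ (F ∪ L)
      lst := L
      disjoint_fst_mid := Finset.disjoint_sdiff.mono_left Finset.subset_union_left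
      disjoint_fst_lst := hFL
      disjoint_mid_lst := (Finset.disjoint_sdiff.mono_left Finset.subset_union_right).symm
      union_eq := by
        ext x
        have h1 : x ∈ F → x ∈ I := fun h => (Finset.mem_filter.1 h).1
        have h2 : x ∈ L → x ∈ I := fun h => (Finset.mem_filter.1 h).1
        simp only [Finset.mem_union, Finset.mem_sdiff]
        tauto }
  have hA : HasSupport U h A := by
    intro S
    constructor
    · intro hS
      have h1 := hU.supp S hS
      refine ⟨⟨fun x hx => (Finset.mem_filter.1 hx).2 S hS, fun x hx => ?_⟩, h1.2⟩
      exact Finset.mem_sdiff.2 ⟨h1.1 hx, fun h2 => (Finset.mem_filter.1 h2).2 S hS hx⟩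
    · rintro ⟨⟨h1, h2⟩, h3⟩
      refine hU.ne_zero_of_forall h3 (fun x hx => ?_) fun x hx hx' => ?_
      · by_contra! h4
        have h5 := Finset.mem_sdiff.1 (h2 hx)
        exact h5.2 (Finset.mem_filter.2 ⟨h5.1, h4⟩)
      · by_contra! h4
        exact hx' (h1 (Finset.mem_filter.2 ⟨hx, h4⟩))
  have hb := (hA S₀).1 hS₀
  have h1 := hb.2 ▸ Finset.card_le_card hb.1.1
  have h2 := hb.2 ▸ Finset.card_le_card hb.1.2
  have hsing : (∀ S, U S ≠ 0 → S = S₀) →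
      ∃ c, c ⊆ I ∧ c.card = h ∧ ∀ S, U S ≠ 0 ↔ S = c := fun h3 =>
    ⟨S₀, (hU.supp _ hS₀).1, (hU.supp _ hS₀).2, fun S => ⟨h3 S, fun h => h ▸ hS₀⟩⟩
  rcases h1.eq_or_lt with h1 | h1
  · refine Or.inl (hsing fun S hS => ?_)
    have h3 := (hA S).1 hS
    rw [← Finset.eq_of_subset_of_card_le h3.1.1 (by omega),
      ← Finset.eq_of_subset_of_card_le hb.1.1 (by omega)]
  rcases h2.eq_or_lt with h2 | h2
  · refine Or.inl (hsing fun S hS => ?_)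
    have h3 := (hA S).1 hS
    rw [Finset.eq_of_subset_of_card_le h3.1.2 (by omega),
      Finset.eq_of_subset_of_card_le hb.1.2 (by omega)]
  exact Or.inr ⟨A, h1, h2, hA⟩

theorem HasSupport.exists_mem_notMem {A : Tripartition I} (hA : HasSupport U h A)
    (h1 : A.fst.card < h) (h2 : h < (I \ A.lst).card) {i j : Δ} (hiI : i ∈ I)
    (hi : i ∉ A.lst) (hj : j ∉ A.fst) (hij : i ≠ j) : ∃ S, U S ≠ 0 ∧ i ∈ S ∧ j ∉ S := by
  have h3 : (insert i A.fst).card ≤ h := (Finset.card_insert_le _ _).trans h1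
  have h4 : h ≤ ((I \ A.lst).erase j).card := by
    have := Finset.pred_card_le_card_erase (s := I \ A.lst) (a := j)
    omega
  obtain ⟨S, hS1, hS2, hS3⟩ := Finset.exists_subsuperset_card_eq (n := h)
    (s := insert i A.fst) (t := (I \ A.lst).erase j) (by
      refine Finset.insert_subset ?_ fun x hx => ?_
      · simp [hij, hiI, hi]
      · have := Finset.disjoint_left.1 A.disjoint_fst_lst hx
        have : x ≠ j := fun h => hj (h ▸ hx)
        have := A.fst_subset hx
        simp [*]) h3 h4
  refine ⟨S, (hA S).2 ⟨⟨(Finset.subset_insert _ _).trans hS1, hS2.trans (Finset.erase_subset _ _)⟩,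
    hS3⟩, hS1 (Finset.mem_insert_self _ _), fun h => ?_⟩
  exact Finset.notMem_erase _ _ (hS2 h)

/-- `U` is monomial on its support, with freely chosen exponentials outside the middle part. -/
theorem IsExchange.exists_scaling (hU : IsExchange I h U) {A : Tripartition I}
    (hA : HasSupport U h A) (h1 : A.fst.card < h) (h2 : h < (I \ A.lst).card) :
    ∃ s₀ : Δ → kˣ, ∀ s : Δ → kˣ, (∀ i ∈ A.mid, s i = s₀ i) →
      ∃ α : kˣ, ∀ S, U S ≠ 0 → U S = α * ∏ i ∈ S, (s i : k) := by
  obtain ⟨c, hc⟩ := hU.nonzero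
  have hcA := (hA c).1 hc
  have hcI := hU.supp c hc
  obtain ⟨j₀, hj₀, hj₀'⟩ : ∃ j ∈ c, j ∉ A.fst := by
    by_contra! h3
    have := Finset.card_le_card h3
    omega
  obtain ⟨l₀, hl₀, hl₀'⟩ : ∃ l ∈ I \ A.lst, l ∉ c := by
    by_contra! h3
    have := Finset.card_le_card h3
    omega
  have hl₀I := (Finset.mem_sdiff.1 hl₀)
  have hswap : ∀ S j i, U S ≠ 0 → j ∈ S → j ∉ A.fst → i ∉ S → i ∈ I → i ∉ A.lst →
      U (swap S j i) ≠ 0 := by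
    intro S j i hS hj hj' hi hiI hi'
    obtain ⟨⟨h3, h4⟩, h5⟩ := (hA S).1 hS
    refine (hA _).2 ⟨⟨fun x hx => ?_, ?_⟩, by rw [card_swap hj hi, h5]⟩
    · exact mem_swap.2 (Or.inr ⟨fun h => hj' (h ▸ hx), h3 hx⟩)
    · exact swap_subset h4 (Finset.mem_sdiff.2 ⟨hiI, hi'⟩)
  let f : Δ → k := fun i =>
    if i ∈ c then U c * U (swap c j₀ l₀) / U (swap c i l₀) else U (swap c j₀ i)
  have hex : ∀ i, ∃ y : kˣ, i ∈ A.mid → (y : k) = f i := by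
    intro i
    by_cases hi : i ∈ A.mid
    · have hi1 := Finset.disjoint_right.1 A.disjoint_fst_mid hi
      have hi2 := Finset.disjoint_left.1 A.disjoint_mid_lst hi
      have hne : f i ≠ 0 := by
        simp only [f]
        split_ifs with hic
        · exact div_ne_zero (mul_ne_zero hc (hswap _ _ _ hc hj₀ hj₀' hl₀' hl₀I.1 hl₀I.2))
            (hswap _ _ _ hc hic hi1 hl₀' hl₀I.1 hl₀I.2)
        · exact hswap _ _ _ hc hj₀ hj₀' hic (A.mid_subset hi) hi2
      exact ⟨Units.mk0 _ hne, fun _ => rfl⟩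
    · exact ⟨1, fun h => absurd h hi⟩
  choose s₀ hs₀ using hex
  refine ⟨s₀, fun s hs => ?_⟩
  have hbase : ∀ j ∈ c, j ∉ A.fst → ∀ i ∈ I, i ∉ A.lst → i ∉ c →
      U (swap c j i) * s j = U c * s i := by
    intro j hj hj' i hi hi' hic
    have hjm : j ∈ A.mid := by
      have h3 := (Finset.mem_sdiff.1 (hcA.1.2 hj))
      have := A.mem_cases h3.1
      tauto
    have him : i ∈ A.mid := by
      have h3 : i ∉ A.fst := fun h => hic (hcA.1.1 h)
      have := A.mem_cases hi
      tauto
    rw [hs j hjm, hs i him, hs₀ j hjm, hs₀ i him]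
    simp only [f, if_pos hj, if_neg hic]
    have hne := hswap _ _ _ hc hj hj' hl₀' hl₀I.1 hl₀I.2
    have key : U (swap c j i) * U (swap c j₀ l₀) = U (swap c j l₀) * U (swap c j₀ i) := by
      by_cases hij : i = l₀
      · rw [hij, mul_comm]
      by_cases hjj : j = j₀
      · rw [hjj, mul_comm]
      have h3 := hU.exch (swap c j i) (swap c j₀ l₀) i l₀ (swap_subset hcI.1 hi)
        (by rw [card_swap hj hic, hcI.2]) (swap_subset hcI.1 hl₀I.1)
        (by rw [card_swap hj₀ hl₀', hcI.2]) (by simp [mem_swap]) (by simp [mem_swap, hij, hic])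
        (by simp [mem_swap]) (by simp [mem_swap, Ne.symm hij, hl₀'])
      have hss : ∀ x y z : Δ, y ∉ c → swap (swap c x y) y z = swap c x z := by
        intro x y z hy
        ext w
        simp only [mem_swap]
        by_cases hw : w = y
        · subst hw
          tauto
        · tauto
      rwa [hss _ _ _ hic, hss _ _ _ hl₀'] at h3
    field_simp
    linear_combination key
  have hind : ∀ n S, U S ≠ 0 → (S \ c).card = n →
      U S * ∏ i ∈ c, (s i : k) = U c * ∏ i ∈ S, (s i : k) := by
    intro n
    induction n with
    | zero =>
      intro S hS hn
      rw [Finset.card_eq_zero, Finset.sdiff_eq_empty_iff_subset] at hn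
      rw [Finset.eq_of_subset_of_card_le hn (by rw [hcI.2, (hU.supp S hS).2])]
    | succ n ih =>
      intro S hS hn
      obtain ⟨i, hi⟩ : (S \ c).Nonempty := by
        rw [← Finset.card_pos]
        omega
      have hi' := Finset.mem_sdiff.1 hi
      have hSI := hU.supp S hS
      have hSA := (hA S).1 hS
      obtain ⟨j, hj, hj'⟩ := exists_mem_notMem_of_card_eq (hSI.2.trans hcI.2.symm) hi'.1 hi'.2
      have hjf : j ∉ A.fst := fun h => hj' (hSA.1.1 h)
      have hil := (Finset.mem_sdiff.1 (hSA.1.2 hi'.1))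
      have hb := hbase j hj hjf i hil.1 hil.2 hi'.2
      have he := hU.exch S c i j hSI.1 hSI.2 hcI.1 hcI.2 hi'.1 hi'.2 hj hj'
      have h3 : swap S i j \ c = (S \ c).erase i := by
        ext x
        simp only [Finset.mem_sdiff, mem_swap, Finset.mem_erase]
        by_cases hx : x = j
        · simp [hx, hj, hj']
        · tauto
      have hr := ih (swap S i j) (hU.swap_ne_zero hS hc hi'.1 hi'.2 hj hj')
        (by rw [h3, Finset.card_erase_of_mem hi, hn, Nat.add_sub_cancel])
      have hp := prod_swap_mul hi'.1 hj' (fun x => (s x : k))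
      apply mul_left_cancel₀ (mul_ne_zero (mul_ne_zero hc (s j).ne_zero) (s i).ne_zero)
      linear_combination (s j * s i * ∏ i ∈ c, (s i : k)) * he +
        (s i * U (swap S i j) * ∏ i ∈ c, (s i : k)) * hb + (U c * s i * s i) * hr +
        (U c * U c * s i) * hp
  have hpne : ∏ i ∈ c, (s i : k) ≠ 0 := Finset.prod_ne_zero_iff.2 fun i _ => (s i).ne_zero
  refine ⟨Units.mk0 (U c / ∏ i ∈ c, (s i : k)) (div_ne_zero hc hpne), fun S hS => ?_⟩
  rw [Units.val_mk0, div_mul_eq_mul_div, eq_div_iff hpne]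
  exact hind _ S hS rfl

/-- There is a set `E` of constrained indices such that `U` is monomial on its support, with
freely chosen factors outside `E`, and the ratios of factors in `E` are values of `U`. -/
theorem IsExchange.exists_constrained (hU : IsExchange I h U) :
    ∃ (E : Finset Δ) (s₀ : Δ → kˣ), E ⊆ I ∧ (∀ s : Δ → kˣ, (∀ i ∈ E, s i = s₀ i) →
      ∃ α : kˣ, ∀ S, U S ≠ 0 → U S = α * ∏ i ∈ S, (s i : k)) ∧
      ∀ i ∈ E, ∀ j ∈ E, i ≠ j → ∃ S, i ∈ S ∧ j ∉ S ∧ U S ≠ 0 ∧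
        U (swap S i j) * s₀ i = U S * s₀ j := by
  rcases hU.support_cases with ⟨c, -, -, hS⟩ | ⟨A, h1, h2, hA⟩
  · refine ⟨∅, 1, Finset.empty_subset _, fun s _ => ?_, by simp⟩
    have hc := (hS c).2 rfl
    have hpne : ∏ i ∈ c, (s i : k) ≠ 0 := Finset.prod_ne_zero_iff.2 fun i _ => (s i).ne_zero
    refine ⟨Units.mk0 (U c / ∏ i ∈ c, (s i : k)) (div_ne_zero hc hpne), fun S hS' => ?_⟩
    rw [(hS S).1 hS', Units.val_mk0, div_mul_cancel₀ _ hpne]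
  · obtain ⟨s₀, hs₀⟩ := hU.exists_scaling hA h1 h2
    refine ⟨A.mid, s₀, A.mid_subset, hs₀, fun i hi j hj hij => ?_⟩
    have hi1 := Finset.disjoint_right.1 A.disjoint_fst_mid hi
    have hi2 := Finset.disjoint_left.1 A.disjoint_mid_lst hi
    have hj1 := Finset.disjoint_right.1 A.disjoint_fst_mid hj
    have hj2 := Finset.disjoint_left.1 A.disjoint_mid_lst hj
    obtain ⟨S, hS, hiS, hjS⟩ := hA.exists_mem_notMem h1 h2 (A.mid_subset hi) hi2 hj1 hij
    obtain ⟨S', hS', hjS', hiS'⟩ :=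
      hA.exists_mem_notMem h1 h2 (A.mid_subset hj) hj2 hi1 hij.symm
    obtain ⟨α, hα⟩ := hs₀ s₀ fun _ _ => rfl
    refine ⟨S, hiS, hjS, hS, ?_⟩
    rw [hα _ hS, hα _ (hU.swap_ne_zero hS hS' hiS hiS' hjS' hjS), mul_assoc, mul_assoc,
      prod_swap_mul hiS hjS fun x => (s₀ x : k)]

end Exchange

section PairOfSupports

variable {Δ : Type*} [DecidableEq Δ] {k : Type*} [Field k] {I J : Finset Δ} {h h₁ h₂ : ℕ}
  {U U₁ U₂ : Finset Δ → k}

/-- Simultaneous opposite exchanges of two elements of `I ∩ J` preserve the supports. -/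
def MixedExchange (I J : Finset Δ) (U₁ U₂ : Finset Δ → k) : Prop :=
  ∀ S T i j, i ∈ I → i ∈ J → j ∈ I → j ∈ J → i ∈ S → j ∉ S → j ∈ T → i ∉ T →
    U₁ S ≠ 0 → U₂ T ≠ 0 → U₁ (swap S i j) ≠ 0 ∧ U₂ (swap T j i) ≠ 0

theorem MixedExchange.symm (h : MixedExchange I J U₁ U₂) : MixedExchange J I U₂ U₁ :=
  fun S T i j hiJ hiI hjJ hjI hi hj hj' hi' hS hT =>
    (h T S j i hjI hjJ hiI hiJ hj' hi' hi hj hT hS).symm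

/-- The tripartition with `I' = E`, `I'' = I \ c`. -/
def singletonTripartition {c E : Finset Δ} (hc : c ⊆ I) (hE : E ⊆ c) : Tripartition I where
  fst := E
  mid := c \ E
  lst := I \ c
  disjoint_fst_mid := Finset.disjoint_sdiff
  disjoint_fst_lst := Finset.disjoint_sdiff.mono_left hE
  disjoint_mid_lst := Finset.disjoint_sdiff.mono_left Finset.sdiff_subset
  union_eq := by rw [Finset.union_sdiff_of_subset hE, Finset.union_sdiff_of_subset hc]

theorem hasSupport_singletonTripartition {c E : Finset Δ} (hc : c ⊆ I) (hE : E ⊆ c)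
    (hcard : c.card = h) (hU : ∀ S, U S ≠ 0 ↔ S = c) :
    HasSupport U h (singletonTripartition hc hE) := by
  intro S
  rw [hU, Tripartition.Between]
  simp only [singletonTripartition, Finset.sdiff_sdiff_eq_self hc]
  constructor
  · rintro rfl
    exact ⟨⟨hE, subset_rfl⟩, hcard⟩
  · rintro ⟨⟨-, h2⟩, h3⟩
    exact Finset.eq_of_subset_of_card_le h2 (by omega)

theorem bounds_singletonTripartition {c E : Finset Δ} (hc : c ⊆ I) (hE : E ⊆ c)
    (hcard : c.card = h) {x : Δ} (hx : x ∈ c) (hx' : x ∉ E) :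
    (singletonTripartition hc hE).Bounds h := by
  constructor
  · rw [← hcard]
    exact Finset.card_lt_card ⟨hE, fun h1 => hx' (h1 hx)⟩
  · simp only [singletonTripartition, Finset.sdiff_sdiff_eq_self hc, hcard, le_refl]

theorem compatible_of_mixedExchange {A : Tripartition I} {B : Tripartition J}
    (hmix : MixedExchange I J U₁ U₂) (hA : HasSupport U₁ h₁ A) (hB : HasSupport U₂ h₂ B)
    (hA1 : A.fst.card < h₁) (hA2 : h₁ < (I \ A.lst).card)
    (hB1 : B.fst.card < h₂) (hB2 : h₂ < (J \ B.lst).card) : Compatible A B := by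
  have H : ∀ i j, i ∈ I → i ∈ J → j ∈ I → j ∈ J → i ≠ j → i ∉ A.lst → i ∉ B.fst → j ∉ A.fst →
      j ∉ B.lst → i ∉ A.fst ∧ i ∉ B.lst ∧ j ∉ A.lst ∧ j ∉ B.fst := by
    intro i j hiI hiJ hjI hjJ hij h1 h2 h3 h4
    obtain ⟨S, hS, hiS, hjS⟩ := hA.exists_mem_notMem hA1 hA2 hiI h1 h3 hij
    obtain ⟨T, hT, hjT, hiT⟩ := hB.exists_mem_notMem hB1 hB2 hjJ h4 h2 hij.symm
    obtain ⟨h5, h6⟩ := hmix S T i j hiI hiJ hjI hjJ hiS hjS hjT hiT hS hT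
    obtain ⟨⟨h7, h8⟩, -⟩ := (hA _).1 h5
    obtain ⟨⟨h9, h10⟩, -⟩ := (hB _).1 h6
    refine ⟨fun h => ?_, fun h => ?_, fun h => ?_, fun h => ?_⟩
    · have := mem_swap.1 (h7 h)
      tauto
    · have := Finset.mem_sdiff.1 (h10 (mem_swap.2 (Or.inl rfl)))
      tauto
    · have := Finset.mem_sdiff.1 (h8 (mem_swap.2 (Or.inl rfl)))
      tauto
    · have := mem_swap.1 (h9 h)
      tauto
  by_cases h1 : Above A B
  · exact h1.compatible
  by_cases h2 : Above B A
  · exact h2.compatible.symm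
  apply SameParts.compatible
  intro l hlI hlJ
  simp only [Above, not_forall, not_or] at h1 h2
  obtain ⟨i, hiI, hiJ, hi1, hi2⟩ := h1
  obtain ⟨j, hjJ, hjI, hj1, hj2⟩ := h2
  have a1 := fun i (hi : i ∈ A.fst) => Finset.disjoint_left.1 A.disjoint_fst_lst hi
  have b1 := fun i (hi : i ∈ B.fst) => Finset.disjoint_left.1 B.disjoint_fst_lst hi
  have H1 := H i j hiI hiJ hjI hjJ
  have H2 := H i l hiI hiJ hlI hlJ
  have H3 := H l j hlI hlJ hjI hjJ
  have H4 := H l i hlI hlJ hiI hiJ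
  have H5 := H j l hjI hjJ hlI hlJ
  grind

theorem exists_compatible_of_singleton_left {c : Finset Δ} (hc : c ⊆ I) (hcard : c.card = h₁)
    (h0 : 0 < h₁) (hU₁ : ∀ S, U₁ S ≠ 0 ↔ S = c) {B : Tripartition J}
    (hmix : MixedExchange I J U₁ U₂) (hB : HasSupport U₂ h₂ B)
    (hB1 : B.fst.card < h₂) (hB2 : h₂ < (J \ B.lst).card) :
    ∃ A : Tripartition I, A.Bounds h₁ ∧ HasSupport U₁ h₁ A ∧ Compatible A B := by
  have H : ∀ i j, i ∈ c → i ∈ J → j ∈ I → j ∉ c → j ∈ J → i ∉ B.fst → j ∈ B.lst := by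
    intro i j hic hiJ hjI hjc hjJ h1
    by_contra h2
    have hij : j ≠ i := fun h => hjc (h ▸ hic)
    obtain ⟨T, hT, hjT, hiT⟩ := hB.exists_mem_notMem hB1 hB2 hjJ h2 h1 hij
    have h3 := (hmix c T i j (hc hic) hiJ hjI hjJ hic hjc hjT hiT ((hU₁ c).2 rfl) hT).1
    rw [hU₁] at h3
    rw [← h3, mem_swap] at hic
    tauto
  have hmk : ∀ E (hE : E ⊆ c) x, x ∈ c → x ∉ E → Compatible (singletonTripartition hc hE) B →
      ∃ A : Tripartition I, A.Bounds h₁ ∧ HasSupport U₁ h₁ A ∧ Compatible A B :=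
    fun E hE x hx hx' hcomp => ⟨_, bounds_singletonTripartition hc hE hcard hx hx',
      hasSupport_singletonTripartition hc hE hcard hU₁, hcomp⟩
  by_cases h1 : ∀ i ∈ c, i ∈ J → i ∈ B.fst
  · obtain ⟨x, hx⟩ : c.Nonempty := by
      rw [← Finset.card_pos]
      omega
    refine hmk ∅ (Finset.empty_subset _) x hx (by simp) (Above.compatible fun i hI hJ => ?_)
    by_cases hic : i ∈ c
    · exact Or.inl (h1 i hic hJ)
    · exact Or.inr (Finset.mem_sdiff.2 ⟨hI, hic⟩)
  push Not at h1
  obtain ⟨i₁, hi₁, hi₁J, hi₁B⟩ := h1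
  by_cases h2 : ∃ i₀ ∈ c, i₀ ∈ J → i₀ ∈ B.lst
  · obtain ⟨i₀, hi₀, hi₀B⟩ := h2
    refine hmk (c.erase i₀) (Finset.erase_subset _ _) i₀ hi₀ (by simp)
      (Compatible.symm (Above.compatible fun i hJ hI => ?_))
    by_cases hi : i = i₀
    · exact Or.inr (hi ▸ hi₀B (hi ▸ hJ))
    · by_cases hic : i ∈ c
      · exact Or.inl (Finset.mem_erase.2 ⟨hi, hic⟩)
      · exact Or.inr (H i₁ i hi₁ hi₁J hI hic hJ hi₁B)
  · push Not at h2
    refine hmk (c ∩ B.fst) Finset.inter_subset_left i₁ hi₁ (by simp [hi₁B])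
      (SameParts.compatible fun i hI hJ => ⟨?_, ?_⟩)
    · simp only [singletonTripartition, Finset.mem_inter, and_iff_right_iff_imp]
      intro hi
      by_contra hic
      exact Finset.disjoint_left.1 B.disjoint_fst_lst hi (H i₁ i hi₁ hi₁J hI hic hJ hi₁B)
    · simp only [singletonTripartition, Finset.mem_sdiff]
      exact ⟨fun h => H i₁ i hi₁ hi₁J hI h.2 hJ hi₁B, fun h => ⟨hI, fun hic => (h2 i hic).2 h⟩⟩

theorem exists_compatible_of_singletons {c d : Finset Δ} (hc : c ⊆ I) (hd : d ⊆ J)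
    (hcard : c.card = h₁) (hcard' : d.card = h₂) (h0 : 0 < h₁) (h0' : 0 < h₂)
    (hcd : ∀ i ∈ c, i ∈ J → i ∈ d) :
    ∃ (E F : Finset Δ) (hE : E ⊆ c) (hF : F ⊆ d),
      (singletonTripartition hc hE).Bounds h₁ ∧ (singletonTripartition hd hF).Bounds h₂ ∧
      Compatible (singletonTripartition hc hE) (singletonTripartition hd hF) := by
  by_cases h1 : ∃ j₀ ∈ d, j₀ ∉ c
  · obtain ⟨j₀, hj₀, hj₀'⟩ := h1
    obtain ⟨x, hx⟩ : c.Nonempty := by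
      rw [← Finset.card_pos]
      omega
    refine ⟨∅, d.erase j₀, Finset.empty_subset _, Finset.erase_subset _ _,
      bounds_singletonTripartition hc _ hcard hx (by simp),
      bounds_singletonTripartition hd _ hcard' hj₀ (by simp), Above.compatible fun i hI hJ => ?_⟩
    by_cases hic : i ∈ c
    · exact Or.inl (Finset.mem_erase.2 ⟨fun h => hj₀' (h ▸ hic), hcd i hic hJ⟩)
    · exact Or.inr (Finset.mem_sdiff.2 ⟨hI, hic⟩)
  · push Not at h1
    obtain ⟨x, hx⟩ : d.Nonempty := by
      rw [← Finset.card_pos]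
      omega
    refine ⟨c.erase x, d.erase x, Finset.erase_subset _ _, Finset.erase_subset _ _,
      bounds_singletonTripartition hc _ hcard (h1 x hx) (by simp),
      bounds_singletonTripartition hd _ hcard' hx (by simp),
      SameParts.compatible fun i hI hJ => ?_⟩
    have h2 := hcd i
    have h3 := h1 i
    simp only [singletonTripartition, Finset.mem_erase, Finset.mem_sdiff]
    tauto

theorem exists_compatible (h0 : 0 < h₁) (h0' : 0 < h₂) (hU₁ : IsExchange I h₁ U₁)
    (hU₂ : IsExchange J h₂ U₂) (hmix : MixedExchange I J U₁ U₂) :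
    ∃ (A : Tripartition I) (B : Tripartition J), A.Bounds h₁ ∧ B.Bounds h₂ ∧ Compatible A B ∧
      HasSupport U₁ h₁ A ∧ HasSupport U₂ h₂ B := by
  rcases hU₁.support_cases with ⟨c, hc, hcard, hS⟩ | ⟨A, hA1, hA2, hA⟩ <;>
    rcases hU₂.support_cases with ⟨d, hd, hcard', hT⟩ | ⟨B, hB1, hB2, hB⟩
  · by_cases h1 : ∀ i ∈ c, i ∈ J → i ∈ d
    · obtain ⟨E, F, hE, hF, hA, hB, hAB⟩ :=
        exists_compatible_of_singletons hc hd hcard hcard' h0 h0' h1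
      exact ⟨_, _, hA, hB, hAB, hasSupport_singletonTripartition hc hE hcard hS,
        hasSupport_singletonTripartition hd hF hcard' hT⟩
    · push Not at h1
      obtain ⟨i, hi, hiJ, hid⟩ := h1
      obtain ⟨F, E, hF, hE, hB, hA, hAB⟩ :=
        exists_compatible_of_singletons hd hc hcard' hcard h0' h0 (by
          intro j hj hjI
          by_contra hjc
          have h3 := (hmix c d i j (hc hi) hiJ hjI (hd hj) hi hjc hj hid ((hS c).2 rfl)
            ((hT d).2 rfl)).1
          rw [hS] at h3
          rw [← h3, mem_swap] at hi
          rcases hi with rfl | hi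
          · exact hid hj
          · exact hi.1 rfl)
      exact ⟨_, _, hA, hB, hAB.symm, hasSupport_singletonTripartition hc hE hcard hS,
        hasSupport_singletonTripartition hd hF hcard' hT⟩
  · obtain ⟨A, hA, hA', hAB⟩ :=
      exists_compatible_of_singleton_left hc hcard h0 hS hmix hB hB1 hB2
    exact ⟨A, B, hA, ⟨hB1, hB2.le⟩, hAB, hA', hB⟩
  · obtain ⟨B, hB, hB', hAB⟩ :=
      exists_compatible_of_singleton_left hd hcard' h0' hT hmix.symm hA hA1 hA2
    exact ⟨A, B, ⟨hA1, hA2.le⟩, hB, hAB.symm, hA, hB'⟩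
  · exact ⟨A, B, ⟨hA1, hA2.le⟩, ⟨hB1, hB2.le⟩,
      compatible_of_mixedExchange hmix hA hB hA1 hA2 hB1 hB2, hA, hB⟩

theorem exists_unit_pow_eq [IsAlgClosed k] {n : ℕ} (hn : 0 < n) (x : kˣ) :
    ∃ y : kˣ, y ^ n = x := by
  obtain ⟨y, hy⟩ := IsAlgClosed.exists_pow_nat_eq (x : k) hn
  have hy0 : y ≠ 0 := by
    rintro rfl
    rw [zero_pow hn.ne'] at hy
    exact x.ne_zero hy.symm
  exact ⟨Units.mk0 y hy0, Units.ext (by simpa using hy)⟩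

theorem exists_torus_scaling [IsAlgClosed k] {lam tau : ℕ} (hlam : 0 < lam) (htau : 0 < tau)
    (hU₁ : IsExchange I h₁ U₁) (hU₂ : IsExchange J h₂ U₂)
    (hmix : ∀ S T i j, i ∈ S → j ∉ S → j ∈ T → i ∉ T → U₁ S ≠ 0 → U₂ T ≠ 0 →
      i ∈ I → i ∈ J → j ∈ I → j ∈ J →
      U₁ S ^ tau * U₂ T ^ lam = U₁ (swap S i j) ^ tau * U₂ (swap T j i) ^ lam) :
    ∃ (s t : Δ → kˣ) (α β : kˣ), (∀ i j, s i ^ tau * t j ^ lam = s j ^ tau * t i ^ lam) ∧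
      (∀ S, U₁ S ≠ 0 → U₁ S = α * ∏ i ∈ S, (s i : k)) ∧
      ∀ T, U₂ T ≠ 0 → U₂ T = β * ∏ i ∈ T, (t i : k) := by
  obtain ⟨E, s₀, hEI, hs₀, hE⟩ := hU₁.exists_constrained
  obtain ⟨F, t₀, hFJ, ht₀, hF⟩ := hU₂.exists_constrained
  choose root hroot using fun (x : kˣ) => exists_unit_pow_eq htau x
  choose root' hroot' using fun (x : kˣ) => exists_unit_pow_eq hlam x
  have key : ∀ i ∈ E, i ∈ F → ∀ j ∈ E, j ∈ F →
      s₀ i ^ tau * t₀ j ^ lam = s₀ j ^ tau * t₀ i ^ lam := by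
    intro i hiE hiF j hjE hjF
    by_cases hij : i = j
    · rw [hij]
    obtain ⟨S, hiS, hjS, hS, hS'⟩ := hE i hiE j hjE hij
    obtain ⟨T, hjT, hiT, hT, hT'⟩ := hF j hjF i hiF (Ne.symm hij)
    have h1 := hmix S T i j hiS hjS hjT hiT hS hT (hEI hiE) (hFJ hiF) (hEI hjE) (hFJ hjF)
    have h2 := congrArg (· ^ tau) hS'
    have h3 := congrArg (· ^ lam) hT'
    simp only [mul_pow] at h2 h3
    ext
    push_cast
    apply mul_left_cancel₀ (mul_ne_zero (pow_ne_zero tau hS) (pow_ne_zero lam hT))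
    linear_combination (s₀ i ^ tau * t₀ j ^ lam : k) * h1 +
      (U₂ (swap T j i) ^ lam * t₀ j ^ lam) * h2 + (U₁ S ^ tau * s₀ j ^ tau) * h3
  obtain ⟨κ, hκ⟩ : ∃ κ : kˣ, ∀ i ∈ E, i ∈ F → s₀ i ^ tau = κ * t₀ i ^ lam := by
    by_cases hne : ∃ j ∈ E, j ∈ F
    · obtain ⟨j, hjE, hjF⟩ := hne
      refine ⟨s₀ j ^ tau / t₀ j ^ lam, fun i hiE hiF => ?_⟩
      rw [div_mul_eq_mul_div, eq_div_iff_mul_eq', key i hiE hiF j hjE hjF]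
    · push Not at hne
      exact ⟨1, fun i hiE hiF => absurd hiF (hne i hiE)⟩
  let t : Δ → kˣ := fun i =>
    if i ∈ F then t₀ i else if i ∈ E then root' (s₀ i ^ tau / κ) else 1
  let s : Δ → kˣ := fun i => if i ∈ E then s₀ i else root (κ * t i ^ lam)
  have hst : ∀ i, s i ^ tau = κ * t i ^ lam := by
    intro i
    simp only [s]
    split_ifs with hiE
    · simp only [t]
      split_ifs with hiF
      · exact hκ i hiE hiF
      · rw [hroot', mul_div_cancel]
    · exact hroot _
  obtain ⟨α, hα⟩ := hs₀ s fun i hi => if_pos hi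
  obtain ⟨β, hβ⟩ := ht₀ t fun i hi => if_pos hi
  refine ⟨s, t, α, β, fun i j => ?_, hα, hβ⟩
  rw [hst, hst, mul_right_comm]

end PairOfSupports

section ClosurePoints

variable {k : Type*} [Field k] {Δ : Type*} {I J : Finset Δ} {h h₁ h₂ : ℕ}

/-- The monomial equations of the closure of a torus orbit. -/
theorem monomial_eq_of_mem_closure {V : Gr k I h₁} {W : Gr k J h₂}
    {T : Subgroup ((I → kˣ) × (J → kˣ))} {P : Gr k I h₁ × Gr k J h₂}
    (hP : P ∈ @closure _ (zariski k I J h₁ h₂) (orbit T (V, W)))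
    {M N : MvPolynomial ((Fin h₁ ↪ I) ⊕ (Fin h₂ ↪ J)) k} {d e : ℕ}
    (hM : MvPolynomial.IsWeightedHomogeneous
      (Sum.elim (fun _ => ((1, 0) : ℕ × ℕ)) (fun _ => ((0, 1) : ℕ × ℕ))) M (d, e))
    (hN : MvPolynomial.IsWeightedHomogeneous
      (Sum.elim (fun _ => ((1, 0) : ℕ × ℕ)) (fun _ => ((0, 1) : ℕ × ℕ))) N (d, e))
    (hT : ∀ p ∈ T, ∃ γ : k,
      MvPolynomial.eval (Sum.elim (fun c => (∏ i, (p.1 (c i) : k)) * plucker V c)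
        (fun c => (∏ i, (p.2 (c i) : k)) * plucker W c)) M =
          γ * MvPolynomial.eval (Sum.elim (plucker V) (plucker W)) M ∧
      MvPolynomial.eval (Sum.elim (fun c => (∏ i, (p.1 (c i) : k)) * plucker V c)
        (fun c => (∏ i, (p.2 (c i) : k)) * plucker W c)) N =
          γ * MvPolynomial.eval (Sum.elim (plucker V) (plucker W)) N) :
    MvPolynomial.eval (Sum.elim (plucker P.1) (plucker P.2)) M *
        MvPolynomial.eval (Sum.elim (plucker V) (plucker W)) N =
      MvPolynomial.eval (Sum.elim (plucker P.1) (plucker P.2)) N *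
        MvPolynomial.eval (Sum.elim (plucker V) (plucker W)) M := by
  rw [mem_closure_zariski_iff] at hP
  set m := MvPolynomial.eval (Sum.elim (plucker V) (plucker W)) M
  set n := MvPolynomial.eval (Sum.elim (plucker V) (plucker W)) N
  by_contra hne
  have hbi : IsBihomogeneous k I J h₁ h₂ (MvPolynomial.C n * M - MvPolynomial.C m * N) := by
    refine ⟨d, e, ?_⟩
    have h1 := (MvPolynomial.isWeightedHomogeneous_C (Sum.elim (fun _ : Fin h₁ ↪ I =>
      ((1, 0) : ℕ × ℕ)) (fun _ : Fin h₂ ↪ J => ((0, 1) : ℕ × ℕ))) n).mul hM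
    have h2 := (MvPolynomial.isWeightedHomogeneous_C (Sum.elim (fun _ : Fin h₁ ↪ I =>
      ((1, 0) : ℕ × ℕ)) (fun _ : Fin h₂ ↪ J => ((0, 1) : ℕ × ℕ))) m).mul hN
    rw [zero_add] at h1 h2
    exact (MvPolynomial.weightedHomogeneousSubmodule k _ _).sub_mem h1 h2
  obtain ⟨_, ⟨p, hp, rfl⟩, hQ⟩ := hP _ hbi (by
    simp only [map_sub, map_mul, MvPolynomial.eval_C]
    intro h0
    exact hne (by linear_combination h0))
  obtain ⟨α, hα⟩ := plucker_act p.1 V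
  obtain ⟨β, hβ⟩ := plucker_act p.2 W
  obtain ⟨γ, h1, h2⟩ := hT p hp
  rw [show plucker (act p.1 V) = _ from funext hα, show plucker (act p.2 W) = _ from funext hβ,
    hbi.eval_mul_ne_zero_iff] at hQ
  apply hQ
  simp only [map_sub, map_mul, MvPolynomial.eval_C, h1, h2]
  ring

variable [DecidableEq Δ]

/-- The ratios of the Plücker coordinates of `V'` and of `V`, as a function of the set of columns
(extended by zero). -/
def pluckerRatio (V V' : Gr k I h) (S : Finset Δ) : k :=
  open Classical in
  if hS : ∃ c : Fin h ↪ I, cols c = S then plucker V' hS.choose / plucker V hS.choose else 0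

theorem exists_of_pluckerRatio_ne_zero {V V' : Gr k I h} {S : Finset Δ}
    (hS : pluckerRatio V V' S ≠ 0) : ∃ c : Fin h ↪ I, cols c = S := by
  by_contra h
  exact hS (dif_neg h)

theorem prod_units_cols (c : Fin h ↪ I) (s : I → kˣ) :
    (∏ i, (s (c i) : k)) = ∏ x ∈ cols c, if hx : x ∈ I then (s ⟨x, hx⟩ : k) else 1 := by
  rw [prod_cols]
  exact Finset.prod_congr rfl fun i _ => by simp

variable {V V' : Gr k I h₁} {W W' : Gr k J h₂} {lam tau : ℕ}

open MvPolynomial in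
theorem pluckerRatio_cols_fst {T : Subgroup ((I → kˣ) × (J → kˣ))}
    (hP : (V', W') ∈ @closure _ (zariski k I J h₁ h₂) (orbit T (V, W)))
    (hV : ∀ c, plucker V c ≠ 0) (c : Fin h₁ ↪ I) :
    pluckerRatio V V' (cols c) = plucker V' c / plucker V c := by
  have hex : ∃ c' : Fin h₁ ↪ I, cols c' = cols c := ⟨c, rfl⟩
  rw [pluckerRatio, dif_pos hex, div_eq_div_iff (hV _) (hV _)]
  have h1 := monomial_eq_of_mem_closure hP (M := X (Sum.inl hex.choose)) (N := X (Sum.inl c))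
    (isWeightedHomogeneous_X _ _ _) (isWeightedHomogeneous_X _ _ _) (fun p _ =>
      ⟨∏ i, (p.1 (c i) : k), by
        simp [prod_units_cols, hex.choose_spec], by simp⟩)
  simpa using h1

open MvPolynomial in
theorem pluckerRatio_cols_snd {T : Subgroup ((I → kˣ) × (J → kˣ))}
    (hP : (V', W') ∈ @closure _ (zariski k I J h₁ h₂) (orbit T (V, W)))
    (hW : ∀ c, plucker W c ≠ 0) (c : Fin h₂ ↪ J) :
    pluckerRatio W W' (cols c) = plucker W' c / plucker W c := by
  have hex : ∃ c' : Fin h₂ ↪ J, cols c' = cols c := ⟨c, rfl⟩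
  rw [pluckerRatio, dif_pos hex, div_eq_div_iff (hW _) (hW _)]
  have h1 := monomial_eq_of_mem_closure hP (M := X (Sum.inr hex.choose)) (N := X (Sum.inr c))
    (isWeightedHomogeneous_X _ _ _) (isWeightedHomogeneous_X _ _ _) (fun p _ =>
      ⟨∏ i, (p.2 (c i) : k), by
        simp [prod_units_cols, hex.choose_spec], by simp⟩)
  simpa using h1

theorem prod_swap_mul_prod_swap {M : Type*} [CommMonoid M] {S S' : Finset Δ} {i j : Δ}
    (hi : i ∈ S) (hi' : i ∉ S') (hj : j ∈ S') (hj' : j ∉ S) (f : Δ → M) :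
    (∏ x ∈ swap S i j, f x) * ∏ x ∈ swap S' j i, f x =
      (∏ x ∈ S, f x) * ∏ x ∈ S', f x := by
  rw [swap, swap, Finset.prod_insert (fun h => hj' (Finset.mem_of_mem_erase h)),
    Finset.prod_insert (fun h => hi' (Finset.mem_of_mem_erase h)),
    ← Finset.mul_prod_erase S f hi, ← Finset.mul_prod_erase S' f hj]
  ac_rfl

theorem isExchange_pluckerRatio {V V' : Gr k I h} (hV : ∀ c, plucker V c ≠ 0)
    (hcols : ∀ c, pluckerRatio V V' (cols c) = plucker V' c / plucker V c)
    (hrel : ∀ c₁ c₂ c₃ c₄ : Fin h ↪ I,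
      (∀ f : Δ → k, (∏ x ∈ cols c₁, f x) * ∏ x ∈ cols c₂, f x =
        (∏ x ∈ cols c₃, f x) * ∏ x ∈ cols c₄, f x) →
      (plucker V' c₁ * plucker V' c₂) * (plucker V c₃ * plucker V c₄) =
        (plucker V' c₃ * plucker V' c₄) * (plucker V c₁ * plucker V c₂)) :
    IsExchange I h (pluckerRatio V V') where
  supp S hS := by
    obtain ⟨c, rfl⟩ := exists_of_pluckerRatio_ne_zero hS
    exact ⟨cols_subset c, card_cols c⟩
  nonzero := by
    obtain ⟨c, hc⟩ := exists_plucker_ne_zero V'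
    exact ⟨cols c, by rw [hcols]; exact div_ne_zero hc (hV c)⟩
  exch S S' i j hS hc hS' hc' hi hi' hj hj' := by
    obtain ⟨c₁, h1⟩ := exists_cols_eq hS hc
    obtain ⟨c₂, h2⟩ := exists_cols_eq hS' hc'
    obtain ⟨c₃, h3⟩ := exists_cols_eq (swap_subset hS (hS' hj)) ((card_swap hi hj').trans hc)
    obtain ⟨c₄, h4⟩ := exists_cols_eq (swap_subset hS' (hS hi)) ((card_swap hj hi').trans hc')
    have h := hrel c₁ c₂ c₃ c₄ (fun f => by
      rw [h1, h2, h3, h4, prod_swap_mul_prod_swap hi hi' hj hj'])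
    rw [← h3, ← h4, ← h1, ← h2, hcols, hcols, hcols, hcols, div_mul_div_comm, div_mul_div_comm,
      div_eq_div_iff (mul_ne_zero (hV _) (hV _)) (mul_ne_zero (hV _) (hV _)), h]

open MvPolynomial in
theorem isExchange_fst {T : Subgroup ((I → kˣ) × (J → kˣ))}
    (hP : (V', W') ∈ @closure _ (zariski k I J h₁ h₂) (orbit T (V, W)))
    (hV : ∀ c, plucker V c ≠ 0) : IsExchange I h₁ (pluckerRatio V V') := by
  refine isExchange_pluckerRatio hV (pluckerRatio_cols_fst hP hV) fun c₁ c₂ c₃ c₄ hc => ?_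
  have h1 := monomial_eq_of_mem_closure hP (M := X (Sum.inl c₁) * X (Sum.inl c₂))
    (N := X (Sum.inl c₃) * X (Sum.inl c₄))
    ((isWeightedHomogeneous_X _ _ _).mul (isWeightedHomogeneous_X _ _ _))
    ((isWeightedHomogeneous_X _ _ _).mul (isWeightedHomogeneous_X _ _ _)) (fun p _ =>
      ⟨(∏ i, (p.1 (c₁ i) : k)) * ∏ i, (p.1 (c₂ i) : k), by simp [mul_mul_mul_comm], by
        rw [prod_units_cols, prod_units_cols, hc, ← prod_units_cols, ← prod_units_cols]
        simp [mul_mul_mul_comm]⟩)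
  simpa using h1

open MvPolynomial in
theorem isExchange_snd {T : Subgroup ((I → kˣ) × (J → kˣ))}
    (hP : (V', W') ∈ @closure _ (zariski k I J h₁ h₂) (orbit T (V, W)))
    (hW : ∀ c, plucker W c ≠ 0) : IsExchange J h₂ (pluckerRatio W W') := by
  refine isExchange_pluckerRatio hW (pluckerRatio_cols_snd hP hW) fun c₁ c₂ c₃ c₄ hc => ?_
  have h1 := monomial_eq_of_mem_closure hP (M := X (Sum.inr c₁) * X (Sum.inr c₂))
    (N := X (Sum.inr c₃) * X (Sum.inr c₄))
    ((isWeightedHomogeneous_X _ _ _).mul (isWeightedHomogeneous_X _ _ _))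
    ((isWeightedHomogeneous_X _ _ _).mul (isWeightedHomogeneous_X _ _ _)) (fun p _ =>
      ⟨(∏ i, (p.2 (c₁ i) : k)) * ∏ i, (p.2 (c₂ i) : k), by simp [mul_mul_mul_comm], by
        rw [prod_units_cols, prod_units_cols, hc, ← prod_units_cols, ← prod_units_cols]
        simp [mul_mul_mul_comm]⟩)
  simpa using h1

open MvPolynomial in
theorem pluckerRatio_mixed
    (hP : (V', W') ∈ @closure _ (zariski k I J h₁ h₂) (orbit (torus k I J lam tau) (V, W)))
    (hV : ∀ c, plucker V c ≠ 0) (hW : ∀ c, plucker W c ≠ 0) {S T : Finset Δ} {i j : Δ}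
    (hi : i ∈ S) (hj : j ∉ S) (hj' : j ∈ T) (hi' : i ∉ T) (hS : pluckerRatio V V' S ≠ 0)
    (hT : pluckerRatio W W' T ≠ 0) (hiI : i ∈ I) (hiJ : i ∈ J) (hjI : j ∈ I) (hjJ : j ∈ J) :
    pluckerRatio V V' S ^ tau * pluckerRatio W W' T ^ lam =
      pluckerRatio V V' (swap S i j) ^ tau * pluckerRatio W W' (swap T j i) ^ lam := by
  obtain ⟨c, hc⟩ := exists_of_pluckerRatio_ne_zero hS
  obtain ⟨d, hd⟩ := exists_of_pluckerRatio_ne_zero hT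
  obtain ⟨c', hc'⟩ := exists_cols_eq (h := h₁) (swap_subset (hc ▸ cols_subset c) hjI)
    ((card_swap hi hj).trans (hc ▸ card_cols c))
  obtain ⟨d', hd'⟩ := exists_cols_eq (h := h₂) (swap_subset (hd ▸ cols_subset d) hiJ)
    ((card_swap hj' hi').trans (hd ▸ card_cols d))
  have hchar : ∀ p ∈ torus k I J lam tau,
      (∏ x, (p.1 (c x) : k)) ^ tau * (∏ x, (p.2 (d x) : k)) ^ lam =
        (∏ x, (p.1 (c' x) : k)) ^ tau * (∏ x, (p.2 (d' x) : k)) ^ lam := by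
    intro p hp
    have h1 := hp i j hiI hiJ hjI hjJ
    have h1' : (p.1 ⟨i, hiI⟩ : k) ^ tau * (p.2 ⟨j, hjJ⟩ : k) ^ lam =
        (p.1 ⟨j, hjI⟩ : k) ^ tau * (p.2 ⟨i, hiJ⟩ : k) ^ lam := by exact_mod_cast h1
    have h2 := prod_swap_mul hi hj fun x => if hx : x ∈ I then (p.1 ⟨x, hx⟩ : k) else 1
    have h3 := prod_swap_mul hj' hi' fun x => if hx : x ∈ J then (p.2 ⟨x, hx⟩ : k) else 1
    rw [← hc, ← prod_units_cols, hc, ← hc', ← prod_units_cols, dif_pos hiI, dif_pos hjI] at h2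
    rw [← hd, ← prod_units_cols, hd, ← hd', ← prod_units_cols, dif_pos hiJ, dif_pos hjJ] at h3
    have h2' := congrArg (· ^ tau) h2
    have h3' := congrArg (· ^ lam) h3
    simp only [mul_pow] at h2' h3'
    apply mul_right_cancel₀ (mul_ne_zero (pow_ne_zero tau (p.1 ⟨j, hjI⟩).ne_zero)
      (pow_ne_zero lam (p.2 ⟨i, hiJ⟩).ne_zero))
    linear_combination (-(∏ x, (p.2 (d x) : k)) ^ lam * (p.2 ⟨i, hiJ⟩ : k) ^ lam) * h2' -
      ((∏ x, (p.1 (c' x) : k)) ^ tau * (p.1 ⟨i, hiI⟩ : k) ^ tau) * h3' +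
      ((∏ x, (p.1 (c' x) : k)) ^ tau * (∏ x, (p.2 (d' x) : k)) ^ lam) * h1'
  have h1 := monomial_eq_of_mem_closure hP (M := X (Sum.inl c) ^ tau * X (Sum.inr d) ^ lam)
    (N := X (Sum.inl c') ^ tau * X (Sum.inr d') ^ lam)
    (((isWeightedHomogeneous_X _ _ _).pow _).mul ((isWeightedHomogeneous_X _ _ _).pow _))
    (((isWeightedHomogeneous_X _ _ _).pow _).mul ((isWeightedHomogeneous_X _ _ _).pow _))
    (fun p hp => ⟨(∏ x, (p.1 (c x) : k)) ^ tau * (∏ x, (p.2 (d x) : k)) ^ lam, by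
        simp [mul_pow, mul_mul_mul_comm], by
        rw [hchar p hp]
        simp [mul_pow, mul_mul_mul_comm]⟩)
  simp only [map_mul, map_pow, eval_X, Sum.elim_inl, Sum.elim_inr] at h1
  rw [← hc', ← hd', ← hc, ← hd, pluckerRatio_cols_fst hP hV, pluckerRatio_cols_fst hP hV,
    pluckerRatio_cols_snd hP hW, pluckerRatio_cols_snd hP hW, div_pow, div_pow, div_pow, div_pow,
    div_mul_div_comm, div_mul_div_comm, div_eq_div_iff
      (mul_ne_zero (pow_ne_zero _ (hV _)) (pow_ne_zero _ (hW _)))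
      (mul_ne_zero (pow_ne_zero _ (hV _)) (pow_ne_zero _ (hW _))), h1]

/-- A point whose Plücker ratios are monomial on the support given by `A` lies in the torus orbit
of `V_A`. -/
theorem eq_act_degeneration {V V' : Gr k I h} (hV : ∀ c, plucker V c ≠ 0)
    (hcols : ∀ c, pluckerRatio V V' (cols c) = plucker V' c / plucker V c)
    {A : Tripartition I} (hA : A.Bounds h) (dA : finrank k (degeneration V.1 A) = h)
    (hsupp : HasSupport (pluckerRatio V V') h A) {s : Δ → kˣ} {α : kˣ}
    (hs : ∀ S, pluckerRatio V V' S ≠ 0 → pluckerRatio V V' S = α * ∏ i ∈ S, (s i : k)) :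
    V' = act (fun i : I => s i) ⟨degeneration V.1 A, dA⟩ := by
  obtain ⟨β, hβ⟩ := plucker_degeneration_eq hV dA hA
  obtain ⟨γ, hγ⟩ := plucker_act (fun i : I => s i) (⟨degeneration V.1 A, dA⟩ : Gr k I h)
  refine (eq_of_plucker_eq (a := ((α * (β⁻¹ * γ⁻¹) : kˣ) : k)) fun c => ?_).symm
  have h1 : plucker V' c = pluckerRatio V V' (cols c) * plucker V c := by
    rw [hcols, div_mul_cancel₀ _ (hV c)]
  rw [hγ, h1]
  by_cases hc : A.Between (cols c)
  · rw [(hβ c).1 hc, hs _ ((hsupp _).2 ⟨hc, card_cols c⟩), prod_cols c (fun i => (s i : k))]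
    have hb := Units.inv_mul β
    have hg := Units.inv_mul γ
    simp only [Units.val_mul]
    linear_combination (-(α * (∏ i, (s (c i) : k)) * plucker V c) * (↑γ⁻¹ * γ)) * hb -
      (α * (∏ i, (s (c i) : k)) * plucker V c) * hg
  · rw [(hβ c).2 hc, not_not.1 (mt (hsupp _).1 fun h => hc h.1)]
    simp

end ClosurePoints

end GrassOrbit

end

open GrassOrbit
theorem lemma9p2 {k : Type*} [Field k] [IsAlgClosed k] {Δ : Type*} [DecidableEq Δ]
    (I J : Finset Δ) (h₁ h₂ : ℕ) (V : Gr k I h₁) (W : Gr k J h₂)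
    (hV0 : V.1 ≠ ⊥) (hW0 : W.1 ≠ ⊥)
    (lam tau : ℕ) (hlam : 0 < lam) (htau : 0 < tau)
    (hV : ∀ b : Fin h₁ ↪ I, plucker V b ≠ 0)
    (hW : ∀ c : Fin h₂ ↪ J, plucker W c ≠ 0) :
    ∃ (dimV : ∀ A : Tripartition I, A.Bounds h₁ →
          Module.finrank k (degeneration V.1 A) = h₁)
      (dimW : ∀ B : Tripartition J, B.Bounds h₂ →
          Module.finrank k (degeneration W.1 B) = h₂),
      @closure _ (zariski k I J h₁ h₂) (orbit (torus k I J lam tau) (V, W)) =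
        ⋃ (A : Tripartition I) (B : Tripartition J) (hA : A.Bounds h₁) (hB : B.Bounds h₂)
          (_ : Compatible A B),
          orbit (torus k I J lam tau)
            (⟨degeneration V.1 A, dimV A hA⟩, ⟨degeneration W.1 B, dimW B hB⟩) := by
  refine ⟨fun A hA => finrank_degeneration hV hA, fun B hB => finrank_degeneration hW hB,
    Set.Subset.antisymm ?_ ?_⟩
  · rintro ⟨V', W'⟩ hP
    have h0 : 0 < h₁ := by
      rw [← V.2, Nat.pos_iff_ne_zero]
      exact fun h => hV0 (Submodule.finrank_eq_zero.1 h)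
    have h0' : 0 < h₂ := by
      rw [← W.2, Nat.pos_iff_ne_zero]
      exact fun h => hW0 (Submodule.finrank_eq_zero.1 h)
    have hU₁ := isExchange_fst hP hV
    have hU₂ := isExchange_snd hP hW
    obtain ⟨A, B, hA, hB, hAB, hsA, hsB⟩ := exists_compatible h0 h0' hU₁ hU₂ (by
      intro S T i j hiI hiJ hjI hjJ hi hj hj' hi' hS hT
      have h1 := pluckerRatio_mixed hP hV hW hi hj hj' hi' hS hT hiI hiJ hjI hjJ
      have h2 := h1 ▸ mul_ne_zero (pow_ne_zero tau hS) (pow_ne_zero lam hT)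
      exact ⟨ne_zero_pow htau.ne' (left_ne_zero_of_mul h2),
        ne_zero_pow hlam.ne' (right_ne_zero_of_mul h2)⟩)
    obtain ⟨s, t, α, β, hst, hs, ht⟩ := exists_torus_scaling hlam htau hU₁ hU₂
      fun S T i j hi hj hj' hi' hS hT => pluckerRatio_mixed hP hV hW hi hj hj' hi' hS hT
    simp only [Set.mem_iUnion]
    refine ⟨A, B, hA, hB, hAB, (fun i => s i, fun i => t i), fun i j _ _ _ _ => hst i j, ?_⟩
    rw [Prod.mk.injEq]
    exact ⟨eq_act_degeneration hV (pluckerRatio_cols_fst hP hV) hA _ hsA hs,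
      eq_act_degeneration hW (pluckerRatio_cols_snd hP hW) hB _ hsB ht⟩
  · intro Q hQ
    simp only [Set.mem_iUnion] at hQ
    obtain ⟨A, B, hA, hB, hAB, p, hp, rfl⟩ := hQ
    have := IsAlgClosed.instInfinite (K := k)
    exact degeneration_mem_closure hlam htau hV hW hA hB hAB _ _ hp
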